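/- Let $n\ge 2$ and let $\mathbb{H}^n=\mathbb{C}^n\times\mathbb{R}$ be the Heisenberg group, with points $(z,t)$, $z=(z_1,\dots,z_n)$, with $|z|^2=\sum_{\alpha=1}^n|z_\alpha|^2$, and with the Lebesgue measure. Put $$Z_\alpha=\partial_{z_\alpha}+\sqrt{-1}\,\overline{z_\alpha}\,\partial_t,\qquad Z_{\overline\alpha}=\partial_{\overline{z_\alpha}}-\sqrt{-1}\,z_\alpha\,\partial_t\qquad(1\le\alpha\le n),$$ and $\Delta_b u=-\operatorname{Re}\sum_{\alpha=1}^n Z_{\overline\alpha}(Z_\alpha u)$. For $R>0$ let $B_R(0)=\{(z,t)\in\mathbb{H}^n:(|z|^4+t^2)^{1/4}<R\}$ be the Korányi ball. Let $u:\mathbb{H}^n\to(0,\infty)$ be a smooth positive solution of the CR Yamabe equation $$4\Delta_b u=n^2u^{\frac{n+2}{n}}\quad\text{in }\mathbb{H}^n,$$ and suppose that there are constants $C>0$ and $q\in\left(\frac{2n+1}{n},\frac{2n+2}{n}\right]$ such that $$\int_{B_R(0)}u^q\le CR^2\qquad\text{for all }R>1.$$ Then there are $\mu\in\mathbb{C}^n$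 and $\lambda\in\mathbb{C}$ with $|\mu|^2<4\operatorname{Im}\lambda$ such that $$u(z,t)=\frac{\left(4\operatorname{Im}\lambda-|\mu|^2\right)^{n/2}}{\left|t+\sqrt{-1}\,|z|^2+\langle\mu,z\rangle+\lambda\right|^n}\qquad\text{for all }(z,t)\in\mathbb{H}^n,$$ where $\langle\mu,z\rangle=\sum_{\alpha=1}^n\overline{\mu_\alpha}z_\alpha$. -/

import Mathlib

open scoped ContDiff ComplexConjugate

noncomputable section

namespace CRYamabe

/-- The space `ℂⁿ × ℝ` underlying the Heisenberg group `ℍⁿ`, with points `(z, t)`.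
It carries its usual smooth structure and the Lebesgue measure `volume`. -/
abbrev Heisenberg (n : ℕ) : Type := (Fin n → ℂ) × ℝ

variable {n : ℕ}

/-- The squared Hermitian norm `|z|² = ∑ |z_α|²` on `ℂⁿ` (the norm that Mathlib puts on
`Fin n → ℂ` is the sup norm, so it is not used here). -/
def sqNorm (z : Fin n → ℂ) : ℝ := ∑ α, ‖z α‖ ^ 2

/-- The Hermitian product `⟨μ, z⟩ = ∑ conj(μ_α) z_α` on `ℂⁿ`, complex linear in `z`. -/
def herm (μ z : Fin n → ℂ) : ℂ := ∑ α, conj (μ α) * z α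

/-- The derivative `∂F/∂x_α`, where `z_α = x_α + i y_α`. -/
def dX (α : Fin n) (F : Heisenberg n → ℂ) (p : Heisenberg n) : ℂ :=
  fderiv ℝ F p (Pi.single α 1, 0)

/-- The derivative `∂F/∂y_α`, where `z_α = x_α + i y_α`. -/
def dY (α : Fin n) (F : Heisenberg n → ℂ) (p : Heisenberg n) : ℂ :=
  fderiv ℝ F p (Pi.single α Complex.I, 0)

/-- The derivative `∂F/∂t`. -/
def dT (F : Heisenberg n → ℂ) (p : Heisenberg n) : ℂ :=
  fderiv ℝ F p (0, 1)

/-- The left-invariant vector field `Z_α = ∂_{z_α} + i conj(z_α) ∂_t`, where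
`∂_{z_α} = (∂_{x_α} - i ∂_{y_α}) / 2`. -/
def Z (α : Fin n) (F : Heisenberg n → ℂ) (p : Heisenberg n) : ℂ :=
  (dX α F p - Complex.I * dY α F p) / 2 + Complex.I * conj (p.1 α) * dT F p

/-- The left-invariant vector field `Z_ᾱ = ∂_{conj z_α} - i z_α ∂_t`, where
`∂_{conj z_α} = (∂_{x_α} + i ∂_{y_α}) / 2`. -/
def Zbar (α : Fin n) (F : Heisenberg n → ℂ) (p : Heisenberg n) : ℂ :=
  (dX α F p + Complex.I * dY α F p) / 2 - Complex.I * p.1 α * dT F p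

/-- The (nonnegative) Heisenberg sub-Laplacian `Δ_b u = - Re ∑_α Z_ᾱ (Z_α u)` of a real function. -/
def subLaplacian (u : Heisenberg n → ℝ) (p : Heisenberg n) : ℝ :=
  -(∑ α, Zbar α (Z α (fun x => (u x : ℂ))) p).re

/-- A positive (smooth, classical) solution of the CR Yamabe equation
`4 Δ_b u = n² u^{(n+2)/n}` in `ℍⁿ`. -/
structure IsPositiveSolution (u : Heisenberg n → ℝ) : Prop where
  smooth : ContDiff ℝ ∞ u
  pos : ∀ p, 0 < u p
  equation : ∀ p, 4 * subLaplacian u p = (n : ℝ) ^ 2 * u p ^ (((n : ℝ) + 2) / n)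

/-- The open Korányi ball `B_R(0) = {(z, t) : (|z|⁴ + t²)^{1/4} < R}`. -/
def koranyiBall (n : ℕ) (R : ℝ) : Set (Heisenberg n) :=
  {p | (sqNorm p.1 ^ 2 + p.2 ^ 2) ^ (1 / 4 : ℝ) < R}

/-- The function
`(z, t) ↦ (4 Im λ - |μ|²)^{n/2} / |t + i |z|² + ⟨μ, z⟩ + λ|ⁿ`, with `lam` for `λ`. -/
def extremal (μ : Fin n → ℂ) (lam : ℂ) (p : Heisenberg n) : ℝ :=
  (4 * lam.im - sqNorm μ) ^ ((n : ℝ) / 2) /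
    ‖(p.2 : ℂ) + Complex.I * (sqNorm p.1 : ℂ) + herm μ p.1 + lam‖ ^ n

end CRYamabe

end

open scoped ContDiff ComplexConjugate
open MeasureTheory Filter Topology

noncomputable section

namespace CRYamabe

variable {n : ℕ}

/-! Write u = 2ⁿ exp(nf), e = exp(2f), f₀ = ∂_t f and g = |∂f|² + e - i f₀. The equation becomes Σ
f_{αᾱ} = -n g. Derivatives of g are expressed through the tensors D, E and the vectors D_α, E_α,
G_α, whose vanishing forces u to be extremal. The Jerison–Lee field X = `jlField` satisfies Re(div X
+ (2n-2) Σ X_α f_ᾱ) ≥ Q, where Q = `jlQuant` ≥ 0 is a sum of squares that controls D, E and G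
(`re_div_jlField`). The task is to integrate this and obtain Q = 0.

The growth hypothesis enters through the weight w = |g|^{-β} exp((2n-2+β)f) with β = 2n+2-nq; the
range of q says exactly 0 ≤ β < 1. Differentiating |g|^{-β} costs at most βQ (`vecTerm_ge`), so a
multiple (1-β)Q survives (`re_div_weighted_jlField`).

With a cutoff ψ at scale R, Young's inequality gives ∫ψ⁶Qw ≤ c R⁻² ∫ψ⁴|g|²w. A second field, (2|∂f|²
- i f₀) f_α, has a divergence that dominates |g|² when n ≥ 2, whence ∫ψ⁴|g|²w ≤ c ∫(e² + R⁻⁴)w +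
small · R² ∫ψ⁶Qw (`gSq_integral_le`). Since |g| ≥ e, the integrand (e² + R⁻⁴)w is at most 2u^q +
R^{-2n} (`weighted_volume_bound`), so its integral over the ball of radius 2R is O(R²). Combining
the two estimates, ∫ψ⁴|g|²w = O(R²) and ∫Qw is bounded. Charging the Young error to the annulus
where ψ varies, whose share of ∫Qw tends to 0, gives ∫Qw = 0 (`jlQuant_eq_zero`).

When Q = 0, the function ζ = i/g is annihilated by every Z_ᾱ and ∂_t ζ = 1. Then ζ - t - i|z|² is
complex affine in z, and u is recovered from |ζ| (`exists_affine_of_jlQuant_eq_zero`). -/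

/-! ### Smooth functions as an algebra with derivations and conjugation -/

/-- The algebra of smooth complex functions on the Heisenberg group. -/
def smoothSubalgebra (n : ℕ) : Subalgebra ℂ (Heisenberg n → ℂ) where
  carrier := {F | ContDiff ℝ ∞ F}
  mul_mem' {_ _} ha hb := by
    simp only [Set.mem_setOf_eq] at *
    exact ha.mul hb
  add_mem' {_ _} ha hb := by
    simp only [Set.mem_setOf_eq] at *
    exact ha.add hb
  algebraMap_mem' c := (contDiff_const : ContDiff ℝ ∞ fun _ : Heisenberg n => c)

/-- The type of smooth complex functions on the Heisenberg group. -/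
abbrev SmoothFun (n : ℕ) : Type := smoothSubalgebra n

theorem SmoothFun.contDiff (F : SmoothFun n) : ContDiff ℝ ∞ (F : Heisenberg n → ℂ) := F.2

theorem SmoothFun.differentiable (F : SmoothFun n) :
    Differentiable ℝ (F : Heisenberg n → ℂ) := F.contDiff.differentiable (by simp)

theorem SmoothFun.continuous (F : SmoothFun n) :
    Continuous (F : Heisenberg n → ℂ) := F.contDiff.continuous

/-- Constant functions. -/
abbrev const (c : ℂ) : SmoothFun n := algebraMap ℂ (SmoothFun n) c

@[simp] theorem const_apply (c : ℂ) (p : Heisenberg n) :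
    (const c : SmoothFun n).1 p = c := rfl

/-- The imaginary unit as a constant function. -/
def iS : SmoothFun n := const Complex.I

theorem iS_sq : (iS : SmoothFun n) ^ 2 = -1 := by
  ext p; simp [iS]

@[simp] theorem iS_apply (p : Heisenberg n) : (iS : SmoothFun n).1 p = Complex.I := rfl

@[simp] theorem SmoothFun.mul_apply (F G : SmoothFun n) (p : Heisenberg n) :
    (F * G).1 p = F.1 p * G.1 p := rfl
@[simp] theorem SmoothFun.add_apply (F G : SmoothFun n) (p : Heisenberg n) :
    (F + G).1 p = F.1 p + G.1 p := rfl
@[simp] theorem SmoothFun.sub_apply (F G : SmoothFun n) (p : Heisenberg n) :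
    (F - G).1 p = F.1 p - G.1 p := rfl
@[simp] theorem SmoothFun.neg_apply (F : SmoothFun n) (p : Heisenberg n) :
    (-F).1 p = -F.1 p := rfl
@[simp] theorem SmoothFun.zero_apply (p : Heisenberg n) : (0 : SmoothFun n).1 p = 0 := rfl
@[simp] theorem SmoothFun.one_apply (p : Heisenberg n) : (1 : SmoothFun n).1 p = 1 := rfl
@[simp] theorem SmoothFun.smul_apply (c : ℂ) (F : SmoothFun n) (p : Heisenberg n) :
    (c • F).1 p = c * F.1 p := rfl
@[simp] theorem SmoothFun.pow_apply (F : SmoothFun n) (k : ℕ) (p : Heisenberg n) :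
    (F ^ k).1 p = F.1 p ^ k := rfl
@[simp] theorem SmoothFun.natCast_apply (k : ℕ) (p : Heisenberg n) :
    ((k : SmoothFun n)).1 p = k := rfl
@[simp] theorem SmoothFun.ofNat_apply (k : ℕ) [k.AtLeastTwo] (p : Heisenberg n) :
    ((ofNat(k) : SmoothFun n)).1 p = ofNat(k) := rfl
@[simp] theorem SmoothFun.sum_apply {ι : Type*} (s : Finset ι) (F : ι → SmoothFun n)
    (p : Heisenberg n) : (∑ i ∈ s, F i).1 p = ∑ i ∈ s, (F i).1 p := by
  simp

@[ext] theorem SmoothFun.ext {F G : SmoothFun n} (h : ∀ p, F.1 p = G.1 p) : F = G :=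
  Subtype.ext (funext h)

/-- The derivative in the direction of a constant vector. -/
def dirDer (v : Heisenberg n) : Derivation ℂ (SmoothFun n) (SmoothFun n) :=
  Derivation.mk'
    { toFun := fun F => ⟨fun p => fderiv ℝ F.1 p v,
        ((F.contDiff.fderiv_right (m := ∞) (by simp)).clm_apply contDiff_const)⟩
      map_add' := fun F G => by
        ext p
        change fderiv ℝ (F.1 + G.1) p v = fderiv ℝ F.1 p v + fderiv ℝ G.1 p v
        rw [fderiv_add F.differentiable.differentiableAt G.differentiable.differentiableAt]
        rfl
      map_smul' := fun c F => by
        ext p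
        change fderiv ℝ (c • F.1) p v = c • fderiv ℝ F.1 p v
        rw [fderiv_const_smul F.differentiable.differentiableAt]
        rfl }
    (fun F G => by
      ext p
      change fderiv ℝ (F.1 * G.1) p v = F.1 p * fderiv ℝ G.1 p v + G.1 p * fderiv ℝ F.1 p v
      rw [fderiv_mul F.differentiable.differentiableAt G.differentiable.differentiableAt]
      rfl)

theorem dirDer_apply (v : Heisenberg n) (F : SmoothFun n) (p : Heisenberg n) :
    (dirDer v F).1 p = fderiv ℝ F.1 p v := rfl

theorem dirDer_comm (v w : Heisenberg n) (F : SmoothFun n) :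
    dirDer v (dirDer w F) = dirDer w (dirDer v F) := by
  have key : ∀ v w : Heisenberg n, ∀ p, (dirDer v (dirDer w F)).1 p =
      fderiv ℝ (fderiv ℝ F.1) p v w := by
    intro v w p
    rw [dirDer_apply]
    change fderiv ℝ (fun x => fderiv ℝ F.1 x w) p v = _
    have hd : DifferentiableAt ℝ (fderiv ℝ F.1) p :=
      ((F.contDiff.fderiv_right (m := ∞) (by simp)).differentiable (by simp)).differentiableAt
    rw [fderiv_clm_apply hd (differentiableAt_const w)]
    simp
  ext p
  rw [key, key]
  exact (F.contDiff.contDiffAt.isSymmSndFDerivAt (by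
    rw [minSmoothness_of_isRCLikeNormedField]; exact WithTop.coe_le_coe.2 le_top)) v w

/-- Complex conjugation of smooth functions. -/
def cj : SmoothFun n →+* SmoothFun n where
  toFun F := ⟨fun p => conj (F.1 p), Complex.conjCLE.contDiff.comp F.contDiff⟩
  map_one' := by ext p; simp
  map_zero' := by ext p; simp
  map_add' F G := by ext p; simp
  map_mul' F G := by ext p; simp

@[simp] theorem cj_apply (F : SmoothFun n) (p : Heisenberg n) :
    (cj F).1 p = conj (F.1 p) := rfl

@[simp] theorem cj_cj (F : SmoothFun n) : cj (cj F) = F := by ext p; simp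

@[simp] theorem cj_const (c : ℂ) : cj (const c : SmoothFun n) = const (conj c) := by
  ext p; simp

@[simp] theorem cj_iS : cj (iS : SmoothFun n) = -iS := by ext p; simp

theorem dirDer_cj (v : Heisenberg n) (F : SmoothFun n) :
    dirDer v (cj F) = cj (dirDer v F) := by
  ext p
  rw [dirDer_apply, cj_apply, dirDer_apply]
  change fderiv ℝ (Complex.conjCLE ∘ F.1) p v = _
  rw [ContinuousLinearEquiv.comp_fderiv]
  simp

/-- The coordinate `z_α`. -/
def zS (α : Fin n) : SmoothFun n :=
  ⟨fun p => p.1 α, by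
    change ContDiff ℝ ∞ fun p : Heisenberg n => p.1 α
    fun_prop⟩

@[simp] theorem zS_apply (α : Fin n) (p : Heisenberg n) : (zS α).1 p = p.1 α := rfl

/-- The coordinate `t`. -/
def tS : SmoothFun n :=
  ⟨fun p => (p.2 : ℂ), by
    change ContDiff ℝ ∞ (Complex.ofRealCLM ∘ fun p : Heisenberg n => p.2)
    exact Complex.ofRealCLM.contDiff.comp contDiff_snd⟩

@[simp] theorem tS_apply (p : Heisenberg n) : (tS : SmoothFun n).1 p = p.2 := rfl

theorem dirDer_zS (v : Heisenberg n) (α : Fin n) : dirDer v (zS α) = const (v.1 α) := by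
  ext p
  rw [dirDer_apply, const_apply]
  change fderiv ℝ ((ContinuousLinearMap.proj (R := ℝ) (φ := fun _ : Fin n => ℂ) α).comp
    (ContinuousLinearMap.fst ℝ (Fin n → ℂ) ℝ)) p v = _
  rw [ContinuousLinearMap.fderiv]
  rfl

theorem dirDer_tS (v : Heisenberg n) : dirDer v tS = const (v.2 : ℂ) := by
  ext p
  rw [dirDer_apply, const_apply]
  change fderiv ℝ (Complex.ofRealCLM.comp (ContinuousLinearMap.snd ℝ (Fin n → ℂ) ℝ)) p v = _
  rw [ContinuousLinearMap.fderiv]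
  rfl

/-! ### The CR frame and its commutation relations -/

/-- `∂_t` as a derivation. -/
def T : Derivation ℂ (SmoothFun n) (SmoothFun n) := dirDer (0, 1)

/-- `Z_α` as a derivation. -/
def L (α : Fin n) : Derivation ℂ (SmoothFun n) (SmoothFun n) :=
  (const (1 / 2) : SmoothFun n) • (dirDer (Pi.single α 1, 0) - (iS : SmoothFun n) • dirDer (Pi.single α Complex.I, 0))
    + (iS * cj (zS α)) • T

/-- `Z_ᾱ` as a derivation. -/
def Lb (α : Fin n) : Derivation ℂ (SmoothFun n) (SmoothFun n) :=
  (const (1 / 2) : SmoothFun n) • (dirDer (Pi.single α 1, 0) + (iS : SmoothFun n) • dirDer (Pi.single α Complex.I, 0))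
    - (iS * zS α) • T

theorem T_apply (F : SmoothFun n) (p : Heisenberg n) : (T F).1 p = dT F.1 p := rfl

theorem L_apply (α : Fin n) (F : SmoothFun n) (p : Heisenberg n) :
    (L α F).1 p = Z α F.1 p := by
  simp [L, Z, dX, dY, dirDer_apply, T_apply]; ring

theorem Lb_apply (α : Fin n) (F : SmoothFun n) (p : Heisenberg n) :
    (Lb α F).1 p = Zbar α F.1 p := by
  simp [Lb, Zbar, dX, dY, dirDer_apply, T_apply]; ring

theorem T_cj (F : SmoothFun n) : T (cj F) = cj (T F) := dirDer_cj _ _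

theorem Lb_cj (α : Fin n) (F : SmoothFun n) : Lb α (cj F) = cj (L α F) := by
  ext p
  simp only [L, Lb, dirDer_cj, T_cj, Derivation.add_apply, Derivation.smul_apply,
    Derivation.sub_apply, smul_eq_mul, SmoothFun.mul_apply, SmoothFun.sub_apply,
    SmoothFun.add_apply, const_apply, cj_apply, iS_apply, map_add, map_sub, map_mul, Complex.conj_I,
    Complex.conj_conj, zS_apply]
  rw [show conj (1 / 2 : ℂ) = 1 / 2 by simp [Complex.ext_iff]]
  ring

theorem L_cj (α : Fin n) (F : SmoothFun n) : L α (cj F) = cj (Lb α F) := by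
  rw [← cj_cj (L α (cj F)), ← Lb_cj, cj_cj]

@[simp] theorem der_const (d : Derivation ℂ (SmoothFun n) (SmoothFun n)) (c : ℂ) :
    d (const c) = 0 := d.map_algebraMap c

@[simp] theorem der_iS (d : Derivation ℂ (SmoothFun n) (SmoothFun n)) : d iS = 0 :=
  d.map_algebraMap _

theorem der_mul (d : Derivation ℂ (SmoothFun n) (SmoothFun n)) (F G : SmoothFun n) :
    d (F * G) = d F * G + F * d G := by
  rw [d.leibniz]; simp only [smul_eq_mul]; ring

theorem der_ofNat_mul (d : Derivation ℂ (SmoothFun n) (SmoothFun n)) (k : ℕ) (F : SmoothFun n) :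
    d (k * F) = k * d F := by
  rw [der_mul, d.map_natCast]; ring

theorem T_zS (α : Fin n) : T (zS α) = 0 := by
  ext p; simp [T, dirDer_zS]

theorem T_tS : T (tS : SmoothFun n) = 1 := by
  ext p; simp [T, dirDer_tS]

theorem L_zS (α β : Fin n) : L α (zS β) = if α = β then 1 else 0 := by
  ext p
  simp only [L, Derivation.add_apply, Derivation.smul_apply, Derivation.sub_apply, dirDer_zS, T_zS]
  by_cases h : α = β
  · subst h; simp; norm_num
  · simp [h, Pi.single_apply, Ne.symm h]

theorem Lb_zS (α β : Fin n) : Lb α (zS β) = 0 := by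
  ext p
  simp only [Lb, Derivation.add_apply, Derivation.smul_apply, Derivation.sub_apply, dirDer_zS, T_zS]
  by_cases h : α = β
  · subst h; simp
  · simp [Pi.single_apply, Ne.symm h]

theorem L_tS (α : Fin n) : L α tS = iS * cj (zS α) := by
  ext p
  simp [L, T_tS, dirDer_tS]

theorem Lb_tS (α : Fin n) : Lb α tS = -(iS * zS α) := by
  ext p
  simp [Lb, T_tS, dirDer_tS]

theorem T_L (α : Fin n) (F : SmoothFun n) : T (L α F) = L α (T F) := by
  simp only [L, T, Derivation.add_apply, Derivation.smul_apply, Derivation.sub_apply, smul_eq_mul,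
    map_add, map_sub, der_mul, der_const, der_iS, dirDer_cj, dirDer_zS,
    dirDer_comm (0, 1)]
  simp

theorem T_Lb (α : Fin n) (F : SmoothFun n) : T (Lb α F) = Lb α (T F) := by
  rw [← cj_cj F, Lb_cj, T_cj, T_L, ← Lb_cj, ← T_cj]

theorem L_L (α β : Fin n) (F : SmoothFun n) : L α (L β F) = L β (L α F) := by
  have h1 : ∀ α β : Fin n, L α (cj (zS β)) = 0 := fun α β => by rw [L_cj, Lb_zS, map_zero]
  have h2 : ∀ α β : Fin n, L α (L β F) = const (1 / 2) *
      (L α (dirDer (Pi.single β 1, 0) F) - iS * L α (dirDer (Pi.single β Complex.I, 0) F))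
      + iS * cj (zS β) * T (L α F) := by
    intro α β
    conv_lhs => rw [L.eq_def β]
    simp only [Derivation.add_apply, Derivation.smul_apply, Derivation.sub_apply, smul_eq_mul,
      map_add, map_sub, der_mul, der_const, der_iS, h1, T_L]
    ring
  rw [h2 α β, h2 β α]
  simp only [L, T, Derivation.add_apply, Derivation.smul_apply, Derivation.sub_apply, smul_eq_mul,
    map_add, map_sub, der_mul, der_const, der_iS, dirDer_cj, dirDer_zS]
  rw [dirDer_comm (Pi.single β 1, 0) (Pi.single α 1, 0),
    dirDer_comm (Pi.single β 1, 0) (Pi.single α Complex.I, 0),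
    dirDer_comm (Pi.single β Complex.I, 0) (Pi.single α 1, 0),
    dirDer_comm (Pi.single β Complex.I, 0) (Pi.single α Complex.I, 0),
    dirDer_comm (0, 1) (Pi.single α 1, 0), dirDer_comm (0, 1) (Pi.single α Complex.I, 0),
    dirDer_comm (0, 1) (Pi.single β 1, 0), dirDer_comm (0, 1) (Pi.single β Complex.I, 0)]
  simp
  ring

theorem Lb_Lb (α β : Fin n) (F : SmoothFun n) : Lb α (Lb β F) = Lb β (Lb α F) := by
  rw [← cj_cj F, Lb_cj, Lb_cj, L_L, ← Lb_cj, ← Lb_cj]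

/-- Noncommutativity comes only from the coefficients: Z_α acts on -i z_β and Z_β̄ acts on i
conj(z_α), and each contributes -i δ_{αβ} ∂_t to the commutator. -/
theorem L_Lb (α β : Fin n) (F : SmoothFun n) :
    L α (Lb β F) = Lb β (L α F) - if α = β then 2 * iS * T F else 0 := by
  have h1 : Lb β (cj (zS α)) = if α = β then 1 else 0 := by
    rw [Lb_cj, L_zS]; by_cases h : α = β
    · simp [h]
    · simp [h, Ne.symm h]
  have e1 : L α (Lb β F) = const (1 / 2) *
      (L α (dirDer (Pi.single β 1, 0) F) + iS * L α (dirDer (Pi.single β Complex.I, 0) F))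
      - iS * zS β * T (L α F) - iS * (if α = β then 1 else 0) * T F := by
    conv_lhs => rw [Lb.eq_def β]
    simp only [Derivation.add_apply, Derivation.smul_apply, Derivation.sub_apply, smul_eq_mul,
      map_add, map_sub, der_mul, der_const, der_iS, L_zS, T_L]
    ring
  have e2 : Lb β (L α F) = const (1 / 2) *
      (Lb β (dirDer (Pi.single α 1, 0) F) - iS * Lb β (dirDer (Pi.single α Complex.I, 0) F))
      + iS * cj (zS α) * T (Lb β F) + iS * (if α = β then 1 else 0) * T F := by
    conv_lhs => rw [L.eq_def α]
    simp only [Derivation.add_apply, Derivation.smul_apply, Derivation.sub_apply, smul_eq_mul,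
      map_add, map_sub, der_mul, der_const, der_iS, h1, T_Lb]
    ring
  have e3 : (const (1 / 2) *
      (L α (dirDer (Pi.single β 1, 0) F) + iS * L α (dirDer (Pi.single β Complex.I, 0) F))
      - iS * zS β * T (L α F)) = const (1 / 2) *
      (Lb β (dirDer (Pi.single α 1, 0) F) - iS * Lb β (dirDer (Pi.single α Complex.I, 0) F))
      + iS * cj (zS α) * T (Lb β F) := by
    simp only [L, Lb, T, Derivation.add_apply, Derivation.smul_apply, Derivation.sub_apply,
      smul_eq_mul, map_add, map_sub, der_mul, der_const, der_iS, dirDer_cj, dirDer_zS]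
    rw [dirDer_comm (Pi.single β 1, 0) (Pi.single α 1, 0),
      dirDer_comm (Pi.single β 1, 0) (Pi.single α Complex.I, 0),
      dirDer_comm (Pi.single β Complex.I, 0) (Pi.single α 1, 0),
      dirDer_comm (Pi.single β Complex.I, 0) (Pi.single α Complex.I, 0),
      dirDer_comm (0, 1) (Pi.single α 1, 0), dirDer_comm (0, 1) (Pi.single α Complex.I, 0),
      dirDer_comm (0, 1) (Pi.single β 1, 0), dirDer_comm (0, 1) (Pi.single β Complex.I, 0)]
    simp
    ring
  rw [e1, e3, e2]
  by_cases h : α = β <;> simp [h]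
  ring

/-- Differentiability of φ is asked only at the one value, so that the rule applies to the
logarithm. -/
theorem dirDer_comp_real (v : Heisenberg n) {r : Heisenberg n → ℝ} {F G : SmoothFun n}
    {φ : ℝ → ℝ} {φ' : ℝ} {p : Heisenberg n} (hr : ∀ x, F.1 x = r x)
    (hG : ∀ x, G.1 x = φ (r x)) (hφ : HasDerivAt φ φ' (r p)) :
    (dirDer v G).1 p = φ' * (dirDer v F).1 p := by
  have hr' : r = fun x => (F.1 x).re := by funext x; simp [hr]
  have h1 : HasFDerivAt r (Complex.reCLM.comp (fderiv ℝ F.1 p)) p := by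
    rw [hr']
    exact Complex.reCLM.hasFDerivAt.comp p (F.differentiable p).hasFDerivAt
  have hF : HasFDerivAt F.1 (Complex.ofRealCLM.comp (Complex.reCLM.comp (fderiv ℝ F.1 p))) p := by
    have : F.1 = fun x => Complex.ofRealCLM (r x) := by funext x; simp [hr]
    conv => arg 1; rw [this]
    exact Complex.ofRealCLM.hasFDerivAt.comp p h1
  have hGd : HasFDerivAt G.1 (Complex.ofRealCLM.comp
      (φ' • (Complex.reCLM.comp (fderiv ℝ F.1 p)))) p := by
    have : G.1 = fun x => Complex.ofRealCLM (φ (r x)) := by funext x; simp [hG]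
    conv => arg 1; rw [this]
    exact Complex.ofRealCLM.hasFDerivAt.comp p (hφ.comp_hasFDerivAt p h1)
  rw [dirDer_apply, dirDer_apply, hGd.fderiv]
  conv_rhs => rw [hF.fderiv]
  simp

theorem Lb_comp_real (α : Fin n) {r : Heisenberg n → ℝ} {F G : SmoothFun n}
    {φ : ℝ → ℝ} {φ' : ℝ} {p : Heisenberg n} (hr : ∀ x, F.1 x = r x)
    (hG : ∀ x, G.1 x = φ (r x)) (hφ : HasDerivAt φ φ' (r p)) :
    (Lb α G).1 p = φ' * (Lb α F).1 p := by
  simp only [Lb, T, Derivation.add_apply, Derivation.smul_apply, Derivation.sub_apply,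
    smul_eq_mul, SmoothFun.mul_apply, SmoothFun.sub_apply, SmoothFun.add_apply,
    dirDer_comp_real _ hr hG hφ]
  ring

/-- A smooth function annihilated by all `Z_α`, `Z_ᾱ` and `∂_t` is constant. -/
theorem eq_const_of_der_eq_zero {F : SmoothFun n} (h1 : ∀ α, L α F = 0) (h2 : ∀ α, Lb α F = 0)
    (h3 : T F = 0) : ∃ c : ℂ, ∀ p, F.1 p = c := by
  have hT : ∀ p, fderiv ℝ F.1 p (0, 1) = 0 := fun p => congrFun (congrArg Subtype.val h3) p
  have hX : ∀ α p, fderiv ℝ F.1 p (Pi.single α 1, 0) = 0 ∧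
      fderiv ℝ F.1 p (Pi.single α Complex.I, 0) = 0 := by
    intro α p
    have e1 := L_apply α F p
    have e2 := Lb_apply α F p
    rw [h1] at e1
    rw [h2] at e2
    simp only [Z, Zbar, dX, dY, dT, hT, SmoothFun.zero_apply] at e1 e2
    refine ⟨by linear_combination -e1 - e2, ?_⟩
    have : Complex.I * fderiv ℝ F.1 p (Pi.single α Complex.I, 0) = 0 := by
      linear_combination e1 - e2
    simpa using this
  have hz : ∀ p, fderiv ℝ F.1 p = 0 := by
    intro p
    refine ContinuousLinearMap.ext fun v => ?_
    have hv : v = ∑ α, ((v.1 α).re • ((Pi.single α 1, 0) : Heisenberg n)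
        + (v.1 α).im • ((Pi.single α Complex.I, 0) : Heisenberg n)) + v.2 • ((0, 1) : Heisenberg n) := by
      refine Prod.ext ?_ ?_
      · funext β
        simp [Prod.fst_sum, Finset.sum_apply, Pi.single_apply, Finset.sum_add_distrib]
      · simp [Prod.snd_sum]
    rw [hv]
    simp only [map_add, map_sum, map_smul, hT, (hX _ p).1, (hX _ p).2]
    simp
  exact ⟨F.1 0, fun p => is_const_of_fderiv_eq_zero F.differentiable hz p 0⟩

/-! ### The Jerison–Lee tensors and their structure equations -/

/-- `|∂f|²`. -/
def gradSq (f : SmoothFun n) : SmoothFun n := ∑ α, L α f * Lb α f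

/-- `g = |∂f|² + e - i f₀`, used with `e = exp (2f)`. -/
def gS (f e : SmoothFun n) : SmoothFun n := gradSq f + e - iS * T f

/-- The tensor `D_{αβ} = f_{αβ} - 2 f_α f_β`. -/
def Dt (f : SmoothFun n) (α β : Fin n) : SmoothFun n := L β (L α f) - 2 * (L α f * L β f)

/-- The tensor `E_{αβ̄} = f_{αβ̄} + g δ_{αβ}`. -/
def Et (f e : SmoothFun n) (α β : Fin n) : SmoothFun n :=
  Lb β (L α f) + if α = β then gS f e else 0

/-- The vector `D_α = D_{αβ} f_β̄`. -/
def Dv (f : SmoothFun n) (α : Fin n) : SmoothFun n := ∑ β, Dt f α β * Lb β f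

/-- The vector `E_α = E_{αβ̄} f_β`. -/
def Ev (f e : SmoothFun n) (α : Fin n) : SmoothFun n := ∑ β, Et f e α β * L β f

/-- The vector `G_α = i f_{0α} + g f_α`. -/
def Gv (f e : SmoothFun n) (α : Fin n) : SmoothFun n := iS * L α (T f) + gS f e * L α f

/-- `f` is a real function with `e = exp (2f)`, and `u = 2ⁿ exp (n f)` solves the CR Yamabe
equation. -/
structure IsYamabeLog (f e : SmoothFun n) : Prop where
  cj_f : cj f = f
  cj_e : cj e = e
  L_e : ∀ α, L α e = 2 * (e * L α f)
  T_e : T e = 2 * (e * T f)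
  equation : ∑ α, Lb α (L α f) = -(n * gS f e)

namespace IsYamabeLog
variable {f e : SmoothFun n} (h : IsYamabeLog f e)
include h

theorem cj_L (α : Fin n) : cj (L α f) = Lb α f := by rw [← Lb_cj, h.cj_f]
theorem cj_Lb (α : Fin n) : cj (Lb α f) = L α f := by rw [← L_cj, h.cj_f]
theorem cj_T : cj (T f) = T f := by rw [← T_cj, h.cj_f]

theorem cj_gradSq : cj (gradSq f) = gradSq f := by
  simp only [gradSq, map_sum, map_mul, h.cj_L, h.cj_Lb]
  exact Finset.sum_congr rfl fun α _ => mul_comm _ _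

theorem cj_gS : cj (gS f e) = gS f e + 2 * (iS * T f) := by
  simp only [gS, map_add, map_sub, map_mul, h.cj_gradSq, h.cj_e, cj_iS, h.cj_T]
  ring

theorem Lb_L (α β : Fin n) :
    Lb β (L α f) = Et f e α β - if α = β then gS f e else 0 := by
  rw [Et]; ring

theorem L_Lb' (α β : Fin n) :
    L β (Lb α f) = Et f e β α - if α = β then cj (gS f e) else 0 := by
  rw [L_Lb, Et, h.cj_gS]
  by_cases hab : α = β
  · subst hab; simp; ring
  · simp [hab, Ne.symm hab]

theorem cj_Et (α β : Fin n) : cj (Et f e α β) = Et f e β α := by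
  have : cj (Lb β (L α f)) = L β (Lb α f) := by rw [← L_cj, h.cj_L]
  rw [Et, map_add, this, h.L_Lb']
  by_cases hab : α = β <;> simp [hab]

omit h in
theorem _root_.CRYamabe.Dt_symm (f : SmoothFun n) (α β : Fin n) : Dt f α β = Dt f β α := by
  rw [Dt, Dt, L_L]; ring

omit h in
theorem _root_.CRYamabe.L_L_eq (f : SmoothFun n) (α β : Fin n) :
    L β (L α f) = Dt f α β + 2 * (L α f * L β f) := by
  rw [Dt]; ring

theorem cj_Dt (α β : Fin n) : cj (Dt f α β) = Lb β (Lb α f) - 2 * (Lb α f * Lb β f) := by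
  rw [Dt, map_sub, map_mul, map_mul, ← Lb_cj, h.cj_L, h.cj_L, map_ofNat]

theorem Lb_Lb_eq (α β : Fin n) :
    Lb β (Lb α f) = cj (Dt f α β) + 2 * (Lb α f * Lb β f) := by
  rw [h.cj_Dt]; ring

theorem L_T (α : Fin n) : L α (T f) = -iS * (Gv f e α - gS f e * L α f) := by
  rw [Gv]; linear_combination (L α (T f)) * iS_sq (n := n)

theorem L_gradSq (α : Fin n) : L α (gradSq f) =
    Dv f α + Ev f e α + 2 * (gradSq f * L α f) - cj (gS f e) * L α f := by
  have h1 : ∀ β, L α (L β f * Lb β f) = Dt f α β * Lb β f + Et f e α β * L β f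
      + 2 * (L β f * Lb β f * L α f) - (if β = α then cj (gS f e) else 0) * L β f := by
    intro β
    rw [der_mul, h.L_Lb', L_L_eq, Dt_symm f β α]; ring
  rw [gradSq, map_sum, Finset.sum_congr rfl fun β _ => h1 β]
  simp only [Finset.sum_sub_distrib, Finset.sum_add_distrib, ite_mul, zero_mul,
    Finset.sum_ite_eq', Finset.mem_univ, if_true, ← Finset.mul_sum, ← Finset.sum_mul]
  rfl

/-- Modulo D, E and G, one has g_α = 2 g f_α, and by `Lb_gS` also g_ᾱ = 0. These relations make i/g
the right unknown in the rigidity step, and they keep the divergence computations closed in D, E, G.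
-/
theorem L_gS (α : Fin n) : L α (gS f e) =
    Dv f α + Ev f e α - Gv f e α + 2 * (gS f e * L α f) := by
  conv_lhs => rw [gS]
  rw [map_sub, map_add, h.L_gradSq, h.L_e, der_mul, der_iS, h.L_T, h.cj_gS]
  rw [show gradSq f = gS f e - e + iS * T f by rw [gS]; ring]
  linear_combination (Gv f e α - gS f e * L α f) * iS_sq (n := n)

theorem L_cj_gS (α : Fin n) : L α (cj (gS f e)) = Dv f α + Ev f e α + Gv f e α := by
  rw [h.cj_gS, map_add, h.L_gS, two_mul (iS * T f), map_add, der_mul, der_iS, h.L_T]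
  linear_combination (-2 * (Gv f e α - gS f e * L α f)) * iS_sq (n := n)

theorem Lb_gS (α : Fin n) : Lb α (gS f e) = cj (Dv f α + Ev f e α + Gv f e α) := by
  rw [← h.L_cj_gS, ← Lb_cj, cj_cj]

theorem Lb_cj_gS (α : Fin n) : Lb α (cj (gS f e)) =
    cj (Dv f α + Ev f e α - Gv f e α) + 2 * (cj (gS f e) * Lb α f) := by
  rw [Lb_cj, h.L_gS, map_add, map_mul, map_mul, h.cj_L, map_ofNat]

theorem Lb_T (α : Fin n) : Lb α (T f) = iS * (cj (Gv f e α) - cj (gS f e) * Lb α f) := by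
  have := congrArg cj (h.L_T α)
  rw [← Lb_cj, h.cj_T] at this
  rw [this]; simp [h.cj_L]

/-- Commuting Z_ᾱ past Z_β produces Z_β of the trace, which the equation replaces by -n g_β, and a
term in f_{0β}, which is rewritten through G. -/
theorem sum_Lb_Dt (β : Fin n) : ∑ α, Lb α (Dt f α β) =
    -n * Dv f β - (n + 2) * (Ev f e β - Gv f e β) := by
  have h1 : ∀ α, Lb α (Dt f α β) = L β (Lb α (L α f))
      + (if β = α then 2 * iS * L β (T f) else 0)
      - 2 * (Lb α (L α f) * L β f) - 2 * (Et f e β α * L α f)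
      + 2 * ((if β = α then gS f e else 0) * L α f) := by
    intro α
    rw [Dt, map_sub, two_mul, map_add, der_mul, h.Lb_L β α, L_Lb]
    by_cases hab : β = α
    · subst hab; simp [T_L]; ring
    · simp [hab]; ring
  rw [Finset.sum_congr rfl fun α _ => h1 α]
  simp only [Finset.sum_sub_distrib, Finset.sum_add_distrib, ite_mul, zero_mul,
    Finset.sum_ite_eq, Finset.mem_univ, if_true, ← Finset.mul_sum, ← Finset.sum_mul, ← map_sum]
  rw [h.equation, map_neg, der_ofNat_mul, h.L_gS, h.L_T]
  change _ - 2 * Ev f e β + _ = _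
  linear_combination (-2 * (Gv f e β - gS f e * L β f)) * iS_sq (n := n)

theorem sum_Lb_Dv : ∑ α, Lb α (Dv f α) = ∑ α, ∑ β, Dt f α β * cj (Dt f α β)
    + (2 - n) * ∑ α, Dv f α * Lb α f - (n + 2) * ∑ α, (Ev f e α - Gv f e α) * Lb α f := by
  have h1 : ∀ α, Lb α (Dv f α) = ∑ β, (Lb α (Dt f α β) * Lb β f
      + Dt f α β * cj (Dt f α β) + 2 * (Dt f α β * Lb β f * Lb α f)) := by
    intro α
    rw [Dv, map_sum]
    refine Finset.sum_congr rfl fun β _ => ?_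
    rw [der_mul, h.Lb_Lb_eq, Dt_symm f β α]; ring
  rw [Finset.sum_congr rfl fun α _ => h1 α]
  simp only [Finset.sum_add_distrib]
  have h2 : ∑ α, ∑ β, Lb α (Dt f α β) * Lb β f =
      ∑ β, (-n * Dv f β - (n + 2) * (Ev f e β - Gv f e β)) * Lb β f := by
    rw [Finset.sum_comm]
    refine Finset.sum_congr rfl fun β _ => ?_
    rw [← Finset.sum_mul, h.sum_Lb_Dt]
  have h3 : ∑ α, ∑ β, 2 * (Dt f α β * Lb β f * Lb α f) = 2 * ∑ α, Dv f α * Lb α f := by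
    rw [Finset.mul_sum]
    refine Finset.sum_congr rfl fun α _ => ?_
    rw [Dv, Finset.sum_mul, Finset.mul_sum]
  have h4 : ∑ β, (-n * Dv f β - (n + 2) * (Ev f e β - Gv f e β)) * Lb β f =
      -n * ∑ α, Dv f α * Lb α f - (n + 2) * ∑ α, (Ev f e α - Gv f e α) * Lb α f := by
    rw [Finset.mul_sum, Finset.mul_sum, ← Finset.sum_sub_distrib]
    exact Finset.sum_congr rfl fun α _ => by ring
  rw [h2, h3, h4]; ring

/-- The fields Z_ᾱ and Z_β̄ commute, so the divergence is the β̄-derivative of the trace, -n g_β̄,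
plus g_β̄ from the diagonal. -/
theorem sum_Lb_Et (β : Fin n) : ∑ α, Lb α (Et f e α β) = -(n - 1) * Lb β (gS f e) := by
  have h1 : ∀ α, Lb α (Et f e α β) = Lb β (Lb α (L α f))
      + if α = β then Lb α (gS f e) else 0 := by
    intro α
    rw [Et, map_add, Lb_Lb]
    by_cases hab : α = β <;> simp [hab]
  rw [Finset.sum_congr rfl fun α _ => h1 α, Finset.sum_add_distrib, ← map_sum, h.equation, map_neg,
    der_ofNat_mul, Finset.sum_ite_eq' Finset.univ β, if_pos (Finset.mem_univ β)]
  ring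

/-- Trace-freeness of E is the equation itself; it removes the g-term from the divergence of E_α. -/
theorem sum_Et_diag : ∑ α, Et f e α α = 0 := by
  simp only [Et, if_true, Finset.sum_add_distrib, h.equation]
  simp

theorem sum_Lb_Ev : ∑ α, Lb α (Ev f e α) = ∑ α, ∑ β, Et f e α β * cj (Et f e α β)
    - (n - 1) * ∑ α, cj (Dv f α + Ev f e α + Gv f e α) * L α f := by
  have h1 : ∀ α, Lb α (Ev f e α) = ∑ β, (Lb α (Et f e α β) * L β f
      + Et f e α β * cj (Et f e α β) - if β = α then Et f e α β * gS f e else 0) := by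
    intro α
    rw [Ev, map_sum]
    refine Finset.sum_congr rfl fun β _ => ?_
    rw [der_mul, h.Lb_L β α, h.cj_Et]
    by_cases hab : β = α <;> simp [hab]
    ring
  rw [Finset.sum_congr rfl fun α _ => h1 α]
  simp only [Finset.sum_add_distrib, Finset.sum_sub_distrib, Finset.sum_ite_eq', Finset.mem_univ,
    if_true, ← Finset.sum_mul, h.sum_Et_diag]
  have h2 : ∑ α, ∑ β, Lb α (Et f e α β) * L β f =
      -(n - 1) * ∑ α, cj (Dv f α + Ev f e α + Gv f e α) * L α f := by
    rw [Finset.sum_comm, Finset.mul_sum]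
    refine Finset.sum_congr rfl fun β _ => ?_
    rw [← Finset.sum_mul, h.sum_Lb_Et, h.Lb_gS]; ring
  rw [h2]; ring

theorem sum_Lb_Gv : ∑ α, Lb α (Gv f e α) = -((n : SmoothFun n) * (iS * T (gS f e)))
    + ∑ α, cj (Dv f α + Ev f e α + Gv f e α) * L α f - (n : SmoothFun n) * gS f e ^ 2 := by
  have h1 : ∀ α, Lb α (Gv f e α) = iS * T (Lb α (L α f))
      + cj (Dv f α + Ev f e α + Gv f e α) * L α f + gS f e * Lb α (L α f) := by
    intro α
    conv_lhs => rw [Gv]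
    rw [map_add, der_mul, der_iS, der_mul, ← T_L, ← T_Lb, h.Lb_gS]; ring
  rw [Finset.sum_congr rfl fun α _ => h1 α]
  simp only [Finset.sum_add_distrib, ← Finset.mul_sum, ← map_sum, h.equation, map_neg,
    der_ofNat_mul]
  ring

/-- The term -i f₀₀ in ∂_t g is not controlled by the tensors, but it is purely imaginary. In the
real part of the divergence of `jlField`, ∂_t g appears only with a real factor, so its real part
suffices. -/
theorem T_gS_add_cj : T (gS f e) + cj (T (gS f e)) =
    2 * (∑ α, iS * (cj (Gv f e α) * L α f - Gv f e α * Lb α f)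
      + 2 * ((gradSq f + e) * T f)) := by
  have h1 : ∀ α, T (L α f * Lb α f) = iS * (cj (Gv f e α) * L α f - Gv f e α * Lb α f)
      + iS * (gS f e - cj (gS f e)) * (L α f * Lb α f) := by
    intro α
    rw [der_mul, T_L, T_Lb, h.Lb_T, h.L_T]; ring
  have h2 : T (gradSq f) = ∑ α, iS * (cj (Gv f e α) * L α f - Gv f e α * Lb α f)
      + 2 * (T f * gradSq f) := by
    rw [gradSq, map_sum, Finset.sum_congr rfl fun α _ => h1 α, Finset.sum_add_distrib,
      ← Finset.mul_sum Finset.univ (fun α => L α f * Lb α f), h.cj_gS]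
    linear_combination (-2 * T f * ∑ i, L i f * Lb i f) * iS_sq (n := n)
  have h3 : cj (T (gradSq f)) = T (gradSq f) := by rw [← T_cj, h.cj_gradSq]
  have h4 : cj (T e) = T e := by rw [← T_cj, h.cj_e]
  have h5 : cj (T (T f)) = T (T f) := by rw [← T_cj, h.cj_T]
  have h6 : T (gS f e) = T (gradSq f) + T e - iS * T (T f) := by
    rw [gS, map_sub, map_add, der_mul, der_iS]; ring
  rw [h6, map_sub, map_add, map_mul, h3, h4, h5, cj_iS, h.T_e, h2]
  ring

end IsYamabeLog

/-! ### Divergences of the Jerison–Lee field and of the auxiliary field -/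

/-- The Jerison–Lee vector field (without its exponential weight). -/
def jlField (f e : SmoothFun n) (α : Fin n) : SmoothFun n :=
  (gS f e + 3 * (iS * T f)) * Ev f e α + (gS f e - iS * T f) * Dv f α
    - 3 * (iS * T f) * Gv f e α

/-- The auxiliary field `(2|∂f|² - i f₀) f_α`. -/
def auxField (f : SmoothFun n) (α : Fin n) : SmoothFun n :=
  (2 * gradSq f - iS * T f) * L α f

theorem der_three_mul (d : Derivation ℂ (SmoothFun n) (SmoothFun n)) (F : SmoothFun n) :
    d (3 * F) = 3 * d F := der_ofNat_mul d 3 F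

theorem der_two_mul (d : Derivation ℂ (SmoothFun n) (SmoothFun n)) (F : SmoothFun n) :
    d (2 * F) = 2 * d F := der_ofNat_mul d 2 F

namespace IsYamabeLog
variable {f e : SmoothFun n} (h : IsYamabeLog f e)
include h

theorem sum_Lb_jlField : ∑ α, Lb α (jlField f e α) =
    ∑ α, ((cj (Dv f α) + cj (Ev f e α) - 2 * cj (Gv f e α)) * Ev f e α
      + (cj (Dv f α) + cj (Ev f e α) + 2 * cj (Gv f e α)) * Dv f α
      + 3 * (cj (Gv f e α) * Gv f e α))
    + cj (gS f e) * (3 * ∑ α, Ev f e α * Lb α f - ∑ α, Dv f α * Lb α f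
      - 3 * ∑ α, Gv f e α * Lb α f)
    + (gS f e + 3 * (iS * T f)) * ∑ α, Lb α (Ev f e α)
    + (gS f e - iS * T f) * ∑ α, Lb α (Dv f α)
    - 3 * (iS * T f) * ∑ α, Lb α (Gv f e α) := by
  simp only [Finset.mul_sum, ← Finset.sum_add_distrib, ← Finset.sum_sub_distrib]
  refine Finset.sum_congr rfl fun α _ => ?_
  simp only [jlField, map_sub, map_add, der_mul _ (_ + _), der_mul _ (_ - _), der_mul _ (3 * _),
    der_three_mul, der_mul _ iS, der_iS, h.Lb_gS, h.Lb_T]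
  linear_combination (cj (Gv f e α) - cj (gS f e) * Lb α f) *
    (3 * Ev f e α - Dv f α - 3 * Gv f e α) * iS_sq (n := n)

theorem Lb_gradSq (α : Fin n) : Lb α (gradSq f) = cj (Dv f α) + cj (Ev f e α)
    + 2 * (gradSq f * Lb α f) - gS f e * Lb α f := by
  rw [← h.cj_gradSq, Lb_cj, h.L_gradSq]
  simp only [map_sub, map_add, map_mul, cj_cj, h.cj_L, h.cj_gradSq, map_ofNat]

theorem sum_Lb_auxField : ∑ α, Lb α (auxField f α) =
    2 * ∑ α, (cj (Dv f α) + cj (Ev f e α)) * L α f + ∑ α, cj (Gv f e α) * L α f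
      + (4 * gradSq f - 2 * gS f e - cj (gS f e)) * gradSq f
      - (2 * gradSq f - iS * T f) * ((n : SmoothFun n) * gS f e) := by
  have h1 : ∀ α, Lb α (auxField f α) = 2 * ((cj (Dv f α) + cj (Ev f e α)) * L α f)
      + cj (Gv f e α) * L α f + (4 * gradSq f - 2 * gS f e - cj (gS f e)) * (L α f * Lb α f)
      + (2 * gradSq f - iS * T f) * Lb α (L α f) := by
    intro α
    rw [auxField, der_mul, map_sub, der_two_mul, der_mul, der_iS, h.Lb_T, h.Lb_gradSq]
    linear_combination (-(cj (Gv f e α) - cj (gS f e) * Lb α f)) * L α f * iS_sq (n := n)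
  rw [Finset.sum_congr rfl fun α _ => h1 α]
  simp only [Finset.sum_add_distrib, ← Finset.mul_sum, h.equation]
  rw [← gradSq]
  ring

end IsYamabeLog

/-! ### The pointwise Jerison–Lee inequality -/

/-- `|∂f|²` as a real function. -/
def gradSqR (f : SmoothFun n) (p : Heisenberg n) : ℝ := ∑ α, Complex.normSq ((L α f).1 p)

/-- The squared norms of the tensors `D_{αβ}` and `E_{αβ̄}`. -/
def tensorSq (f e : SmoothFun n) (p : Heisenberg n) : ℝ :=
  ∑ α, ∑ β, (Complex.normSq ((Dt f α β).1 p) + Complex.normSq ((Et f e α β).1 p))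

/-- The contribution of the index `α` to the vector part of the Jerison–Lee quantity. -/
def vecTerm (D E G : ℂ) : ℝ :=
  Complex.normSq G + Complex.normSq (G + D) + Complex.normSq (G - E) + Complex.normSq (D + E)

/-- The vector part of the Jerison–Lee quantity. -/
def vecSq (f e : SmoothFun n) (p : Heisenberg n) : ℝ :=
  ∑ α, vecTerm ((Dv f α).1 p) ((Ev f e α).1 p) ((Gv f e α).1 p)

/-- A lower bound for the Jerison–Lee quantity. -/
def jlQuant (f e : SmoothFun n) (p : Heisenberg n) : ℝ :=
  vecSq f e p + (e.1 p).re * tensorSq f e p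

/-- All terms linear in the pairings of D, E, G with ∂f cancel in the real part, owing to the
coefficients of `jlField` and the exponent 2n-2 of the weight. The cancellation needs the E-pairing
to be real and the formula for Re ∂_t g. -/
theorem jl_linear_terms (N a b tD tE : ℝ) (dD dE dG tg : ℂ) (hE : dE.im = 0)
    (htg : tg.re = 2 * dG.im + 2 * (a * b)) :
    ((a + Complex.I * b) * (3 * dE - dD - 3 * dG)
      + (a + 2 * (Complex.I * b)) * (tE - (N - 1) * conj (dD + dE + dG))
      + (a - 2 * (Complex.I * b)) * (tD + (2 - N) * dD - (N + 2) * (dE - dG))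
      - 3 * (Complex.I * b) * (-(N * (Complex.I * tg)) + conj (dD + dE + dG)
        - N * (a - Complex.I * b) ^ 2)).re
      + (2 * N - 2) * ((a + 2 * (Complex.I * b)) * dE + (a - 2 * (Complex.I * b)) * dD
        - 3 * (Complex.I * b) * dG).re = a * (tD + tE) := by
  simp [pow_two, hE]
  linear_combination -3 * b * N * htg

/-- The constant 1 on the right is decisive: it makes the loss from |g|^{-β} at most β times the
vector part, which is affordable for every β < 1. -/
theorem vecTerm_ge (D E G : ℂ) (a b : ℝ) (hr : 0 < a ^ 2 + b ^ 2) :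
    (((a + 2 * (Complex.I * b)) * E + (a - 2 * (Complex.I * b)) * D - 3 * (Complex.I * b) * G)
      * (a * conj (D + E) + Complex.I * b * conj G)).re ≤ vecTerm D E G * (a ^ 2 + b ^ 2) := by
  obtain ⟨d1, d2⟩ := D
  obtain ⟨e1, e2⟩ := E
  obtain ⟨g1, g2⟩ := G
  simp only [vecTerm, Complex.normSq_apply, Complex.add_re, Complex.add_im, Complex.sub_re,
    Complex.sub_im, Complex.mul_re, Complex.mul_im, Complex.I_re, Complex.I_im, Complex.ofReal_re,
    Complex.ofReal_im, Complex.conj_re, Complex.conj_im, Complex.re_ofNat, Complex.im_ofNat, map_add]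
  rw [← sub_nonneg]
  refine nonneg_of_mul_nonneg_left (b := a ^ 2 + b ^ 2) ?_ hr
  -- After multiplication by a² + b², the difference of the two sides is exactly this sum of
  -- squares.
  have h0 : 0 ≤ 1 / 2 * (((a ^ 2 + b ^ 2) * (e1 - d1 - 2 * g1) + 2 * b ^ 2 * g1
        - 2 * a * b * (d2 + e2)) ^ 2 + ((a ^ 2 + b ^ 2) * (e2 - d2 - 2 * g2) + 2 * b ^ 2 * g2
        + 2 * a * b * (d1 + e1)) ^ 2)
      + a ^ 4 / 2 * ((d1 + e1) ^ 2 + (d2 + e2) ^ 2)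
      + (a ^ 4 + a ^ 2 * b ^ 2 / 3) * (g1 ^ 2 + g2 ^ 2)
      + 3 / 2 * ((-b ^ 2 * (d2 + e2) - 4 / 3 * a * b * g1) ^ 2
        + (b ^ 2 * (d1 + e1) - 4 / 3 * a * b * g2) ^ 2) := by positivity
  refine h0.trans_eq ?_
  ring


theorem normSq_sum_mul_le {ι : Type*} (s : Finset ι) (x y : ι → ℂ) :
    Complex.normSq (∑ i ∈ s, x i * y i) ≤
      (∑ i ∈ s, Complex.normSq (x i)) * ∑ i ∈ s, Complex.normSq (y i) := by
  simp only [Complex.normSq_eq_norm_sq]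
  calc ‖∑ i ∈ s, x i * y i‖ ^ 2 ≤ (∑ i ∈ s, ‖x i‖ * ‖y i‖) ^ 2 := by
        gcongr
        exact (norm_sum_le _ _).trans_eq (by simp)
    _ ≤ _ := Finset.sum_mul_sq_le_sq_mul_sq _ _ _

namespace IsYamabeLog
variable {f e : SmoothFun n} (h : IsYamabeLog f e)
include h

theorem Lb_apply_eq (α : Fin n) (p : Heisenberg n) :
    (Lb α f).1 p = conj ((L α f).1 p) := by rw [← h.cj_L, cj_apply]

theorem gradSq_apply (p : Heisenberg n) : (gradSq f).1 p = (gradSqR f p : ℂ) := by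
  simp [gradSq, gradSqR, h.Lb_apply_eq, Complex.mul_conj]

theorem T_apply_eq (p : Heisenberg n) : (T f).1 p = (((T f).1 p).re : ℂ) := by
  have := congrArg (fun F : SmoothFun n => F.1 p) h.cj_T
  exact (Complex.conj_eq_iff_re.1 this).symm

theorem e_apply_eq (p : Heisenberg n) : e.1 p = ((e.1 p).re : ℂ) := by
  have := congrArg (fun F : SmoothFun n => F.1 p) h.cj_e
  exact (Complex.conj_eq_iff_re.1 this).symm

theorem gS_apply (p : Heisenberg n) : (gS f e).1 p =
    ((gradSqR f p + (e.1 p).re : ℝ) : ℂ) - Complex.I * (((T f).1 p).re : ℂ) := by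
  conv_lhs => rw [gS]
  rw [SmoothFun.sub_apply, SmoothFun.add_apply, SmoothFun.mul_apply, h.gradSq_apply]
  conv_lhs => rw [h.e_apply_eq, h.T_apply_eq]
  simp

theorem sum_normSq_Dv_add_Ev_le (p : Heisenberg n) :
    ∑ α, (Complex.normSq ((Dv f α).1 p) + Complex.normSq ((Ev f e α).1 p)) ≤
      gradSqR f p * tensorSq f e p := by
  rw [tensorSq, Finset.mul_sum]
  refine Finset.sum_le_sum fun α _ => ?_
  rw [Finset.sum_add_distrib, mul_add]
  gcongr
  · simp only [Dv, SmoothFun.sum_apply, SmoothFun.mul_apply]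
    refine (normSq_sum_mul_le _ _ _).trans_eq ?_
    rw [mul_comm]
    simp [gradSqR, h.Lb_apply_eq]
  · simp only [Ev, SmoothFun.sum_apply, SmoothFun.mul_apply]
    refine (normSq_sum_mul_le _ _ _).trans_eq ?_
    rw [mul_comm, gradSqR]

/-- The pairing is the Hermitian form E evaluated on ∂f. -/
theorem sum_Ev_im (p : Heisenberg n) : (∑ α, (Ev f e α).1 p * (Lb α f).1 p).im = 0 := by
  rw [← Complex.conj_eq_iff_im]
  simp only [map_sum, Ev, map_mul, SmoothFun.sum_apply, SmoothFun.mul_apply, Finset.sum_mul]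
  rw [Finset.sum_comm]
  refine Finset.sum_congr rfl fun β _ => Finset.sum_congr rfl fun α _ => ?_
  rw [← cj_apply, h.cj_Et, ← cj_apply, h.cj_L, ← cj_apply, h.cj_Lb]
  ring

/-- The left-over of the exact identity is (|∂f|² + e)(|D|² + |E|²) plus a quadratic form in the
vectors. Cauchy–Schwarz spends the |∂f|² part to supply the Σ(|D_α|² + |E_α|²) that this form lacks
to become `vecSq`; the e part stays. -/
theorem re_div_jlField (p : Heisenberg n) :
    jlQuant f e p ≤ (∑ α, (Lb α (jlField f e α)).1 p).re
      + (2 * n - 2) * (∑ α, (jlField f e α).1 p * (Lb α f).1 p).re := by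
  set a : ℝ := gradSqR f p + (e.1 p).re with ha
  set b : ℝ := ((T f).1 p).re with hb
  set dD := ∑ α, (Dv f α).1 p * (Lb α f).1 p with hdD
  set dE := ∑ α, (Ev f e α).1 p * (Lb α f).1 p with hdE
  set dG := ∑ α, (Gv f e α).1 p * (Lb α f).1 p with hdG
  set tD := ∑ α, ∑ β, Complex.normSq ((Dt f α β).1 p) with htD
  set tE := ∑ α, ∑ β, Complex.normSq ((Et f e α β).1 p) with htE
  set tg := (T (gS f e)).1 p with htg
  have hcd : ∀ F : Fin n → SmoothFun n, ∑ α, conj ((F α).1 p) * (L α f).1 p =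
      conj (∑ α, (F α).1 p * (Lb α f).1 p) := by
    intro F
    rw [map_sum]
    exact Finset.sum_congr rfl fun α _ => by
      rw [map_mul, ← cj_apply (Lb α f), h.cj_Lb]
  have hg : (gS f e).1 p = a - Complex.I * b := h.gS_apply p
  have hT : (T f).1 p = (b : ℂ) := h.T_apply_eq p
  have hgb : (cj (gS f e)).1 p = a + Complex.I * b := by rw [cj_apply, hg]; simp
  have hDEG : ∑ α, conj ((Dv f α).1 p + (Ev f e α).1 p + (Gv f e α).1 p) * (L α f).1 p =
      conj (dD + dE + dG) := by
    have := hcd fun α => Dv f α + Ev f e α + Gv f e α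
    simp only [SmoothFun.add_apply, add_mul, Finset.sum_add_distrib] at this
    rw [← this]
  have h1 : ∑ α, (Lb α (Dv f α)).1 p = tD + (2 - n) * dD - (n + 2) * (dE - dG) := by
    have := congrArg (fun F : SmoothFun n => F.1 p) h.sum_Lb_Dv
    simp only [SmoothFun.sum_apply, SmoothFun.add_apply, SmoothFun.sub_apply, SmoothFun.mul_apply,
      SmoothFun.ofNat_apply, SmoothFun.natCast_apply, cj_apply, Complex.mul_conj, sub_mul,
      Finset.sum_sub_distrib] at this
    rw [this, htD, hdD, hdE, hdG]
    push_cast; ring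
  have h2 : ∑ α, (Lb α (Ev f e α)).1 p = tE - (n - 1) * conj (dD + dE + dG) := by
    have := congrArg (fun F : SmoothFun n => F.1 p) h.sum_Lb_Ev
    simp only [SmoothFun.sum_apply, SmoothFun.add_apply, SmoothFun.sub_apply, SmoothFun.mul_apply,
      SmoothFun.one_apply, SmoothFun.natCast_apply, cj_apply, Complex.mul_conj] at this
    rw [this, hDEG, htE]
    push_cast; ring
  have h3 : ∑ α, (Lb α (Gv f e α)).1 p = -(n * (Complex.I * tg)) + conj (dD + dE + dG)
      - n * (a - Complex.I * b) ^ 2 := by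
    have := congrArg (fun F : SmoothFun n => F.1 p) h.sum_Lb_Gv
    simp only [SmoothFun.sum_apply, SmoothFun.add_apply, SmoothFun.sub_apply, SmoothFun.mul_apply,
      SmoothFun.neg_apply, SmoothFun.pow_apply, SmoothFun.natCast_apply, cj_apply, iS_apply] at this
    rw [this, hDEG, hg]
  have h4 : tg.re = 2 * dG.im + 2 * (a * b) := by
    have := congrArg (fun F : SmoothFun n => F.1 p) h.T_gS_add_cj
    simp only [SmoothFun.sum_apply, SmoothFun.add_apply, SmoothFun.sub_apply, SmoothFun.mul_apply,
      SmoothFun.ofNat_apply, cj_apply, iS_apply, mul_sub, Finset.sum_sub_distrib,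
      ← Finset.mul_sum, h.gradSq_apply, hT] at this
    rw [hcd (Gv f e), ← hdG, h.e_apply_eq, Complex.add_conj] at this
    have h5 := congrArg Complex.re this
    simp at h5
    rw [ha]
    linarith
  have h6 : ∑ α, (jlField f e α).1 p * (Lb α f).1 p = (a + 2 * (Complex.I * b)) * dE
      + (a - 2 * (Complex.I * b)) * dD - 3 * (Complex.I * b) * dG := by
    rw [hdD, hdE, hdG]
    simp only [Finset.mul_sum, ← Finset.sum_add_distrib, ← Finset.sum_sub_distrib]
    refine Finset.sum_congr rfl fun α _ => ?_
    simp only [jlField, SmoothFun.add_apply, SmoothFun.sub_apply, SmoothFun.mul_apply,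
      SmoothFun.ofNat_apply, iS_apply, hg, hT]
    ring
  have h7 := congrArg (fun F : SmoothFun n => F.1 p) h.sum_Lb_jlField
  simp only [SmoothFun.sum_apply, SmoothFun.add_apply, SmoothFun.sub_apply, SmoothFun.mul_apply,
    SmoothFun.ofNat_apply, iS_apply, hT, hgb, hg] at h7
  rw [← hdD, ← hdE, ← hdG, h1, h2, h3] at h7
  have h8 := jl_linear_terms n a b tD tE dD dE dG tg (h.sum_Ev_im p) h4
  have h9 := h.sum_normSq_Dv_add_Ev_le p
  have h10 : tensorSq f e p = tD + tE := by
    simp only [tensorSq, htD, htE, Finset.sum_add_distrib]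
  have h11 : vecSq f e p = (∑ α, ((conj ((Dv f α).1 p) + conj ((Ev f e α).1 p)
      - 2 * conj ((Gv f e α).1 p)) * (Ev f e α).1 p
      + (conj ((Dv f α).1 p) + conj ((Ev f e α).1 p) + 2 * conj ((Gv f e α).1 p)) * (Dv f α).1 p
      + 3 * (conj ((Gv f e α).1 p) * (Gv f e α).1 p))).re
      + ∑ α, (Complex.normSq ((Dv f α).1 p) + Complex.normSq ((Ev f e α).1 p)) := by
    rw [vecSq, Complex.re_sum, ← Finset.sum_add_distrib]
    refine Finset.sum_congr rfl fun α _ => ?_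
    simp [vecTerm, Complex.normSq_apply]
    ring
  rw [h6, h7, jlQuant, h11]
  rw [h10] at h9 ⊢
  simp only [cj_apply]
  simp only [Complex.add_re, Complex.sub_re] at h8 ⊢
  have hcast : ((a : ℂ) - Complex.I * b + 3 * (Complex.I * b)) = a + 2 * (Complex.I * b) := by ring
  have hcast' : ((a : ℂ) - Complex.I * b - Complex.I * b) = a - 2 * (Complex.I * b) := by ring
  rw [hcast, hcast']
  push_cast at h8
  linarith

end IsYamabeLog

/-! ### Weighted pointwise inequalities with a cutoff -/

/-- `|g|²`. -/
def gSq (f e : SmoothFun n) (p : Heisenberg n) : ℝ := Complex.normSq ((gS f e).1 p)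

/-- `W` is a positive weight with the logarithmic derivative of `|g|^{-β} exp ((2n-2+β) f)`. -/
structure IsWeight (f e W : SmoothFun n) (w : Heisenberg n → ℝ) (β : ℝ) : Prop where
  apply_eq : ∀ p, W.1 p = w p
  pos : ∀ p, 0 < w p
  Lb_apply : ∀ α p, (Lb α W).1 p = w p * ((2 * n - 2) * (Lb α f).1 p
    - β * ((gradSqR f p + (e.1 p).re : ℝ) * conj ((Dv f α).1 p + (Ev f e α).1 p)
      + Complex.I * ((T f).1 p).re * conj ((Gv f e α).1 p)) / gSq f e p)

theorem vecTerm_nonneg (D E G : ℂ) : 0 ≤ vecTerm D E G := by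
  simp only [vecTerm]
  have := Complex.normSq_nonneg
  linarith [this G, this (G + D), this (G - E), this (D + E)]

/-- Write D = (G + D) - G and E = G - (G - E): this gives 5|G|² + 2|G + D|² + 2|G - E|². -/
theorem sum_normSq_le_vecTerm (D E G : ℂ) :
    Complex.normSq D + Complex.normSq E + Complex.normSq G ≤ 5 * vecTerm D E G := by
  simp only [vecTerm, Complex.normSq_apply, Complex.add_re, Complex.add_im, Complex.sub_re,
    Complex.sub_im]
  nlinarith [sq_nonneg (2 * G.re + D.re), sq_nonneg (2 * G.im + D.im),
    sq_nonneg (2 * G.re - E.re), sq_nonneg (2 * G.im - E.im), sq_nonneg (G.re + D.re),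
    sq_nonneg (G.im + D.im), sq_nonneg (G.re - E.re), sq_nonneg (G.im - E.im), sq_nonneg D.re,
    sq_nonneg E.re, sq_nonneg D.im, sq_nonneg E.im, sq_nonneg G.re, sq_nonneg G.im,
    sq_nonneg (D.re + E.re), sq_nonneg (D.im + E.im)]

theorem normSq_add_three_le (x y z : ℂ) :
    Complex.normSq (x + y + z) ≤ 3 * (Complex.normSq x + Complex.normSq y + Complex.normSq z) := by
  simp only [Complex.normSq_apply, Complex.add_re, Complex.add_im]
  nlinarith [sq_nonneg (x.re - y.re), sq_nonneg (x.re - z.re), sq_nonneg (y.re - z.re),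
    sq_nonneg (x.im - y.im), sq_nonneg (x.im - z.im), sq_nonneg (y.im - z.im)]

theorem normSq_jl_le (D E G : ℂ) (a b : ℝ) :
    Complex.normSq ((a + 2 * (Complex.I * b)) * E + (a - 2 * (Complex.I * b)) * D
      - 3 * (Complex.I * b) * G) ≤ 27 * (a ^ 2 + b ^ 2) *
        (Complex.normSq D + Complex.normSq E + Complex.normSq G) := by
  have h := normSq_add_three_le ((a + 2 * (Complex.I * b)) * E) ((a - 2 * (Complex.I * b)) * D)
    (-(3 * (Complex.I * b)) * G)
  have h1 : Complex.normSq (a + 2 * (Complex.I * b)) = a ^ 2 + 4 * b ^ 2 := by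
    simp [Complex.normSq_apply]; ring
  have h2 : Complex.normSq (a - 2 * (Complex.I * b)) = a ^ 2 + 4 * b ^ 2 := by
    simp [Complex.normSq_apply]; ring
  have h3 : Complex.normSq (-(3 * (Complex.I * b))) = 9 * b ^ 2 := by
    simp [Complex.normSq_apply]; ring
  rw [Complex.normSq_mul, Complex.normSq_mul, Complex.normSq_mul, h1, h2, h3] at h
  rw [sub_eq_add_neg, ← neg_mul]
  refine h.trans ?_
  have hD := Complex.normSq_nonneg D
  have hE := Complex.normSq_nonneg E
  have hG := Complex.normSq_nonneg G
  nlinarith [mul_nonneg (sq_nonneg a) hD, mul_nonneg (sq_nonneg a) hE, mul_nonneg (sq_nonneg a) hG,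
    mul_nonneg (sq_nonneg b) hD, mul_nonneg (sq_nonneg b) hE, mul_nonneg (sq_nonneg b) hG]

/-- The constant is 1215 = 3² · 5 · 27: the 3 is half of the 6 from differentiating ψ⁶, the 27 is
that of `normSq_jl_le`, and the 5 offsets the factor in `sum_normSq_le_vecTerm`. -/
theorem cutoff_young {x τ r q : ℝ} (X v : ℂ) (hx : 0 ≤ x) (hτ : 0 < τ) (hr : 0 < r)
    (hX : Complex.normSq X ≤ 27 * r * q) :
    -(τ * x ^ 6 * q / 5 + 1215 / τ * r * x ^ 4 * Complex.normSq v) ≤ 6 * x ^ 5 * (X * v).re := by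
  have h1 : -(‖X‖ * ‖v‖) ≤ (X * v).re := by
    rw [← norm_mul]; exact neg_le_of_abs_le (Complex.abs_re_le_norm _)
  rw [Complex.normSq_eq_norm_sq] at *
  have h2 : 6 * x ^ 5 * (‖X‖ * ‖v‖) ≤ τ * x ^ 6 * q / 5 + 1215 / τ * r * x ^ 4 * ‖v‖ ^ 2 := by
    have h3 : τ * x ^ 6 * q / 5 + 1215 / τ * r * x ^ 4 * ‖v‖ ^ 2 - 6 * x ^ 5 * (‖X‖ * ‖v‖) =
        ((τ * x ^ 3 * ‖X‖ - 405 * r * x ^ 2 * ‖v‖) ^ 2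
          + τ ^ 2 * x ^ 6 * (27 * r * q - ‖X‖ ^ 2)) / (135 * r * τ) := by
      field_simp; ring
    have h4 : 0 ≤ 27 * r * q - ‖X‖ ^ 2 := by linarith
    rw [← sub_nonneg, h3]
    positivity
  have h5 : 0 ≤ 6 * x ^ 5 := by positivity
  nlinarith [mul_le_mul_of_nonneg_left h1 h5]

theorem gradSqR_nonneg (f : SmoothFun n) (p : Heisenberg n) : 0 ≤ gradSqR f p :=
  Finset.sum_nonneg fun _ _ => Complex.normSq_nonneg _

theorem tensorSq_nonneg (f e : SmoothFun n) (p : Heisenberg n) : 0 ≤ tensorSq f e p :=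
  Finset.sum_nonneg fun _ _ => Finset.sum_nonneg fun _ _ =>
    add_nonneg (Complex.normSq_nonneg _) (Complex.normSq_nonneg _)

theorem vecSq_nonneg (f e : SmoothFun n) (p : Heisenberg n) : 0 ≤ vecSq f e p :=
  Finset.sum_nonneg fun _ _ => vecTerm_nonneg _ _ _

namespace IsYamabeLog
variable {f e : SmoothFun n} (h : IsYamabeLog f e)
include h

theorem gSq_eq (p : Heisenberg n) :
    gSq f e p = (gradSqR f p + (e.1 p).re) ^ 2 + ((T f).1 p).re ^ 2 := by
  rw [gSq, h.gS_apply]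
  simp [Complex.normSq_apply]; ring

theorem jlField_apply (α : Fin n) (p : Heisenberg n) : (jlField f e α).1 p =
    ((gradSqR f p + (e.1 p).re : ℝ) + 2 * (Complex.I * ((T f).1 p).re)) * (Ev f e α).1 p
    + ((gradSqR f p + (e.1 p).re : ℝ) - 2 * (Complex.I * ((T f).1 p).re)) * (Dv f α).1 p
    - 3 * (Complex.I * ((T f).1 p).re) * (Gv f e α).1 p := by
  simp only [jlField, SmoothFun.add_apply, SmoothFun.sub_apply, SmoothFun.mul_apply,
      SmoothFun.ofNat_apply, iS_apply, h.gS_apply]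
  rw [← h.T_apply_eq]
  ring

variable (he : ∀ p, 0 < (e.1 p).re)
include he

omit h in
theorem jlQuant_nonneg (p : Heisenberg n) : 0 ≤ jlQuant f e p :=
  add_nonneg (vecSq_nonneg f e p) (mul_nonneg (he p).le (tensorSq_nonneg f e p))

omit h in
theorem vecSq_le_jlQuant (p : Heisenberg n) : vecSq f e p ≤ jlQuant f e p :=
  le_add_of_nonneg_right (mul_nonneg (he p).le (tensorSq_nonneg f e p))

theorem gSq_pos (p : Heisenberg n) : 0 < gSq f e p := by
  rw [h.gSq_eq]
  have := gradSqR_nonneg f p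
  have := he p
  positivity

/-- The factor exp((2n-2)f) in the logarithmic derivative of w completes the divergence to the form
of `re_div_jlField`; the rest is absorbed by `vecTerm_ge`. -/
theorem re_div_weighted_jlField {W : SmoothFun n} {w : Heisenberg n → ℝ} {β : ℝ}
    (hW : IsWeight f e W w β) (hβ : 0 ≤ β) (c : SmoothFun n) (p : Heisenberg n) {x : ℝ}
    (hc : c.1 p = x) (hx : 0 ≤ x) :
    w p * (x * ((1 - β) * jlQuant f e p)
        + (∑ α, (jlField f e α).1 p * (Lb α c).1 p).re)
      ≤ (∑ α, (Lb α (c * W * jlField f e α)).1 p).re := by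
  have hr := h.gSq_pos he p
  have h1 := h.re_div_jlField p
  have h2 : ∀ α, (Lb α (c * W * jlField f e α)).1 p =
      (w p : ℂ) * ((x : ℂ) * ((Lb α (jlField f e α)).1 p
        + ((2 * n - 2 : ℝ) : ℂ) * ((jlField f e α).1 p * (Lb α f).1 p)
        - ((β / gSq f e p : ℝ) : ℂ) * ((jlField f e α).1 p *
          ((gradSqR f p + (e.1 p).re : ℝ) * conj ((Dv f α).1 p + (Ev f e α).1 p)
            + Complex.I * ((T f).1 p).re * conj ((Gv f e α).1 p))))
        + (jlField f e α).1 p * (Lb α c).1 p) := by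
    intro α
    rw [der_mul, der_mul]
    simp only [SmoothFun.add_apply, SmoothFun.mul_apply, hW.Lb_apply, hW.apply_eq, hc]
    push_cast
    ring
  have h3 : (∑ α, ((jlField f e α).1 p *
          ((gradSqR f p + (e.1 p).re : ℝ) * conj ((Dv f α).1 p + (Ev f e α).1 p)
            + Complex.I * ((T f).1 p).re * conj ((Gv f e α).1 p)))).re
      ≤ vecSq f e p * gSq f e p := by
    rw [Complex.re_sum, vecSq, Finset.sum_mul]
    refine Finset.sum_le_sum fun α _ => ?_
    rw [h.gSq_eq, h.jlField_apply]
    exact vecTerm_ge _ _ _ _ _ (by rw [← h.gSq_eq]; exact hr)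
  rw [Finset.sum_congr rfl fun α _ => h2 α, ← Finset.mul_sum, Complex.re_ofReal_mul]
  refine mul_le_mul_of_nonneg_left ?_ (hW.pos p).le
  rw [Finset.sum_add_distrib, Complex.add_re, ← Finset.mul_sum, Complex.re_ofReal_mul]
  gcongr
  rw [Finset.sum_sub_distrib, Finset.sum_add_distrib, ← Finset.mul_sum, ← Finset.mul_sum,
    Complex.sub_re, Complex.add_re, Complex.re_ofReal_mul, Complex.re_ofReal_mul]
  have h4 := mul_le_mul_of_nonneg_left h3 (div_nonneg hβ hr.le)
  have h5 : β / gSq f e p * (vecSq f e p * gSq f e p) = β * vecSq f e p := by field_simp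
  have h6 := mul_le_mul_of_nonneg_left (vecSq_le_jlQuant (f := f) he p) hβ
  linarith

theorem re_div_cutoff_jlField {W : SmoothFun n} {w : Heisenberg n → ℝ} {β : ℝ}
    (hW : IsWeight f e W w β) (hβ : 0 ≤ β) (ψ : SmoothFun n) (p : Heisenberg n) {x : ℝ}
    (hψ : ψ.1 p = x) (hx : 0 ≤ x) {τ : ℝ} (hτ : 0 < τ) :
    w p * ((1 - β - τ) * (x ^ 6 * jlQuant f e p)
        - 1215 / τ * gSq f e p * x ^ 4 * ∑ α, Complex.normSq ((Lb α ψ).1 p))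
      ≤ (∑ α, (Lb α (ψ ^ 6 * W * jlField f e α)).1 p).re := by
  refine le_trans ?_ (h.re_div_weighted_jlField he hW hβ (ψ ^ 6) p (x := x ^ 6) (by simp [hψ])
    (by positivity))
  refine mul_le_mul_of_nonneg_left ?_ (hW.pos p).le
  have h1 : ∀ α, -(τ * x ^ 6 * vecTerm ((Dv f α).1 p) ((Ev f e α).1 p) ((Gv f e α).1 p)
      + 1215 / τ * gSq f e p * x ^ 4 * Complex.normSq ((Lb α ψ).1 p))
      ≤ ((jlField f e α).1 p * (Lb α (ψ ^ 6)).1 p).re := by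
    intro α
    have h2 : (jlField f e α).1 p * (Lb α (ψ ^ 6)).1 p =
        ((6 * x ^ 5 : ℝ) : ℂ) * ((jlField f e α).1 p * (Lb α ψ).1 p) := by
      rw [Derivation.leibniz_pow]
      simp [hψ]
      ring
    have h3 := cutoff_young ((jlField f e α).1 p) ((Lb α ψ).1 p) hx hτ (h.gSq_pos he p)
      (by
        rw [h.jlField_apply, h.gSq_eq]
        exact normSq_jl_le ((Dv f α).1 p) ((Ev f e α).1 p) ((Gv f e α).1 p) _ _)
    have h4 := sum_normSq_le_vecTerm ((Dv f α).1 p) ((Ev f e α).1 p) ((Gv f e α).1 p)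
    have h5 : 0 ≤ τ * x ^ 6 := by positivity
    rw [h2, Complex.re_ofReal_mul]
    nlinarith [mul_le_mul_of_nonneg_left h4 h5]
  rw [Complex.re_sum]
  have h2 := Finset.sum_le_sum fun α (_ : α ∈ Finset.univ) => h1 α
  rw [Finset.sum_neg_distrib, Finset.sum_add_distrib, ← Finset.mul_sum, ← Finset.mul_sum] at h2
  rw [← vecSq] at h2
  have h3 := mul_le_mul_of_nonneg_left (vecSq_le_jlQuant (f := f) he p)
    (by positivity : 0 ≤ τ * x ^ 6)
  linarith

end IsYamabeLog

theorem neg_norm_mul_le_re (X v : ℂ) : -(‖X‖ * ‖v‖) ≤ (X * v).re := by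
  rw [← norm_mul]; exact neg_le_of_abs_le (Complex.abs_re_le_norm _)

/-- Both factors coming from the field and from the derivative of |g|^{-β} are O(√r), which cancels
the division by r = |g|². The constant 5 covers 2 + 1 from the divergence and 2 from the weight. -/
theorem re_error_ge (D E G z : ℂ) {p a b r β : ℝ} (hp : 0 ≤ p) (hpa : p ≤ a)
    (hr : r = a ^ 2 + b ^ 2) (hr0 : 0 < r) (hβ : 0 ≤ β) (hβ1 : β ≤ 1) :
    -(5 * ((‖D‖ + ‖E‖ + ‖G‖) * ‖z‖)) ≤ (2 * ((conj D + conj E) * z) + conj G * z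
      - (β / r : ℝ) * ((2 * p - Complex.I * b) * z *
        (a * conj (D + E) + Complex.I * b * conj G))).re := by
  have ha : |a| ≤ √r := Real.abs_le_sqrt (by nlinarith)
  have hb : |b| ≤ √r := Real.abs_le_sqrt (by nlinarith)
  have h1 : ‖(2 * p - Complex.I * b : ℂ)‖ ≤ 2 * √r := by
    rw [← Real.sqrt_sq (by norm_num : (0 : ℝ) ≤ 2), ← Real.sqrt_mul (by norm_num)]
    refine Real.le_sqrt_of_sq_le ?_
    rw [← Complex.normSq_eq_norm_sq]
    simp [Complex.normSq_apply]
    nlinarith [sq_nonneg b]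
  have h2 : ‖a * conj (D + E) + Complex.I * b * conj G‖ ≤ √r * (‖D‖ + ‖E‖ + ‖G‖) := by
    refine (norm_add_le _ _).trans ?_
    simp only [norm_mul, Complex.norm_real, Real.norm_eq_abs, RCLike.norm_conj, Complex.norm_I,
      one_mul]
    have := mul_le_mul ha (norm_add_le D E) (norm_nonneg _) (Real.sqrt_nonneg _)
    have := mul_le_mul_of_nonneg_right hb (norm_nonneg G)
    linarith
  have h3 : ‖((β / r : ℝ) : ℂ) * ((2 * p - Complex.I * b) * z *
        (a * conj (D + E) + Complex.I * b * conj G))‖ ≤ 2 * ((‖D‖ + ‖E‖ + ‖G‖) * ‖z‖) := by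
    rw [norm_mul, norm_mul, norm_mul, Complex.norm_real, Real.norm_eq_abs,
      abs_of_nonneg (div_nonneg hβ hr0.le)]
    calc β / r * (‖(2 * p - Complex.I * b : ℂ)‖ * ‖z‖ *
          ‖a * conj (D + E) + Complex.I * b * conj G‖)
        ≤ 1 / r * (2 * √r * ‖z‖ * (√r * (‖D‖ + ‖E‖ + ‖G‖))) := by gcongr
      _ = (√r * √r) / r * (2 * ((‖D‖ + ‖E‖ + ‖G‖) * ‖z‖)) := by ring
      _ = _ := by rw [Real.mul_self_sqrt hr0.le, div_self hr0.ne', one_mul]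
  have h4 : ‖2 * ((conj D + conj E) * z)‖ ≤ 2 * ((‖D‖ + ‖E‖) * ‖z‖) := by
    rw [norm_mul, norm_mul]
    simp only [Complex.norm_ofNat]
    gcongr
    exact (norm_add_le _ _).trans_eq (by simp)
  have h5 : ‖conj G * z‖ = ‖G‖ * ‖z‖ := by simp
  refine neg_le_of_abs_le ((Complex.abs_re_le_norm _).trans ?_)
  refine (norm_sub_le _ _).trans ((add_le_add (norm_add_le _ _) h3).trans ?_)
  have := mul_nonneg (norm_nonneg G) (norm_nonneg z)
  have := mul_nonneg (norm_nonneg D) (norm_nonneg z)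
  have := mul_nonneg (norm_nonneg E) (norm_nonneg z)
  linarith

/-- Young's inequality with (D, E, G) bounded by 15 `vecTerm`; the sharp constant 25 · 15 / 4 =
93.75 is rounded up to 94. -/
theorem error_young (D E G z : ℂ) {x ρ σ : ℝ} (hρ : 0 < ρ) (hσ : 0 < σ) :
    x ^ 4 * (5 * ((‖D‖ + ‖E‖ + ‖G‖) * ‖z‖)) ≤
      σ * x ^ 6 / ρ ^ 2 * vecTerm D E G + 94 / σ * ρ ^ 2 * x ^ 2 * Complex.normSq z := by
  have h1 := sum_normSq_le_vecTerm D E G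
  simp only [Complex.normSq_eq_norm_sq] at *
  have h2 : (‖D‖ + ‖E‖ + ‖G‖) ^ 2 ≤ 15 * vecTerm D E G := by
    nlinarith [sq_nonneg (‖D‖ - ‖E‖), sq_nonneg (‖D‖ - ‖G‖), sq_nonneg (‖E‖ - ‖G‖)]
  set y := ‖D‖ + ‖E‖ + ‖G‖
  have h3 : σ * x ^ 6 / ρ ^ 2 * vecTerm D E G + 94 / σ * ρ ^ 2 * x ^ 2 * ‖z‖ ^ 2
      - x ^ 4 * (5 * (y * ‖z‖)) =
      ((σ * x ^ 3 * y - 37.5 * ρ ^ 2 * x * ‖z‖) ^ 2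
        + σ ^ 2 * x ^ 6 * (15 * vecTerm D E G - y ^ 2)
        + 3.75 * ρ ^ 4 * x ^ 2 * ‖z‖ ^ 2) / (15 * ρ ^ 2 * σ) := by
    field_simp; ring
  rw [← sub_nonneg, h3]
  have := sub_nonneg.2 h2
  positivity

namespace IsYamabeLog
variable {f e : SmoothFun n} (h : IsYamabeLog f e) (he : ∀ p, 0 < (e.1 p).re)
include h he

/-- The field is chosen so that the tensor-free part of its weighted divergence is (2n-3)|∂f|⁴ -
(2n+3)|∂f|² e + n f₀². For n ≥ 2 this is coercive and bounds |g|² up to a multiple of e². -/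
theorem re_div_weighted_auxField (hn : 2 ≤ n) {W : SmoothFun n} {w : Heisenberg n → ℝ} {β : ℝ}
    (hW : IsWeight f e W w β) (hβ : 0 ≤ β) (hβ1 : β ≤ 1) (c : SmoothFun n) (p : Heisenberg n)
    {x : ℝ} (hc : c.1 p = x) (hx : 0 ≤ x) :
    w p * (x * (gSq f e p / 4 - (2 * n + 3) ^ 2 * (e.1 p).re ^ 2
        - 5 * ∑ α, ((‖(Dv f α).1 p‖ + ‖(Ev f e α).1 p‖ + ‖(Gv f e α).1 p‖) * ‖(L α f).1 p‖))
        + (∑ α, (auxField f α).1 p * (Lb α c).1 p).re)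
      ≤ (∑ α, (Lb α (c * W * auxField f α)).1 p).re := by
  have hr := h.gSq_pos he p
  set P := gradSqR f p with hP
  set e0 := (e.1 p).re with he0
  set b : ℝ := ((T f).1 p).re with hb
  have hP0 : 0 ≤ P := gradSqR_nonneg f p
  have he0' : 0 < e0 := he p
  have hY : ∀ α, (auxField f α).1 p = (2 * P - Complex.I * b) * (L α f).1 p := by
    intro α
    simp only [auxField, SmoothFun.mul_apply, SmoothFun.sub_apply, SmoothFun.ofNat_apply,
      h.gradSq_apply, iS_apply, hP]
    rw [h.T_apply_eq]
  have hYz : ∑ α, (auxField f α).1 p * (Lb α f).1 p = (2 * P - Complex.I * b) * P := by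
    simp only [hY, mul_assoc, ← Finset.mul_sum, h.Lb_apply_eq, Complex.mul_conj]
    rw [hP, gradSqR]; push_cast; rfl
  have hdiv := congrArg (fun F : SmoothFun n => F.1 p) h.sum_Lb_auxField
  simp only [SmoothFun.sum_apply, SmoothFun.add_apply, SmoothFun.sub_apply, SmoothFun.mul_apply,
    SmoothFun.ofNat_apply, SmoothFun.natCast_apply, iS_apply, cj_apply, h.gradSq_apply,
    h.gS_apply] at hdiv
  rw [← hP, ← hb, ← he0, h.T_apply_eq, ← hb] at hdiv
  have h2 : ∀ α, (Lb α (c * W * auxField f α)).1 p =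
      (w p : ℂ) * ((x : ℂ) * ((Lb α (auxField f α)).1 p
        + ((2 * n - 2 : ℝ) : ℂ) * ((auxField f α).1 p * (Lb α f).1 p)
        - ((β / gSq f e p : ℝ) : ℂ) * ((auxField f α).1 p *
          ((P + e0 : ℝ) * conj ((Dv f α).1 p + (Ev f e α).1 p)
            + Complex.I * b * conj ((Gv f e α).1 p))))
        + (auxField f α).1 p * (Lb α c).1 p) := by
    intro α
    rw [der_mul, der_mul]
    simp only [SmoothFun.add_apply, SmoothFun.mul_apply, hW.Lb_apply, hW.apply_eq, hc]
    push_cast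
    ring
  have h3 : ∀ α, -(5 * ((‖(Dv f α).1 p‖ + ‖(Ev f e α).1 p‖ + ‖(Gv f e α).1 p‖) * ‖(L α f).1 p‖))
      ≤ (2 * ((conj ((Dv f α).1 p) + conj ((Ev f e α).1 p)) * (L α f).1 p)
        + conj ((Gv f e α).1 p) * (L α f).1 p
        - ((β / gSq f e p : ℝ) : ℂ) * ((auxField f α).1 p *
          ((P + e0 : ℝ) * conj ((Dv f α).1 p + (Ev f e α).1 p)
            + Complex.I * b * conj ((Gv f e α).1 p)))).re := by
    intro α
    rw [hY]
    exact re_error_ge _ _ _ _ hP0 (by linarith) (h.gSq_eq p) hr hβ hβ1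
  have h4 := Finset.sum_le_sum fun α (_ : α ∈ Finset.univ) => h3 α
  rw [Finset.sum_neg_distrib, ← Complex.re_sum, Finset.sum_sub_distrib, Finset.sum_add_distrib,
    ← Finset.mul_sum, ← Finset.mul_sum, ← Finset.mul_sum] at h4
  rw [Finset.sum_congr rfl fun α _ => h2 α, ← Finset.mul_sum, Complex.re_ofReal_mul]
  refine mul_le_mul_of_nonneg_left ?_ (hW.pos p).le
  rw [Finset.sum_add_distrib, Complex.add_re, ← Finset.mul_sum, Complex.re_ofReal_mul]
  gcongr
  rw [Finset.sum_sub_distrib, Finset.sum_add_distrib, ← Finset.mul_sum, ← Finset.mul_sum, hYz,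
    hdiv]
  have hn' : (2 : ℝ) ≤ n := by exact_mod_cast hn
  have h5 : gSq f e p / 4 - (2 * n + 3) ^ 2 * e0 ^ 2 ≤
      (2 * n - 3) * P ^ 2 - (2 * n + 3) * (P * e0) + n * b ^ 2 := by
    rw [h.gSq_eq, ← hP, ← he0, ← hb]
    nlinarith [sq_nonneg (P - (2 * n + 3) * e0), sq_nonneg (P - e0), sq_nonneg P, sq_nonneg b,
      mul_nonneg (sub_nonneg.2 hn') (sq_nonneg P), mul_nonneg (sub_nonneg.2 hn') (sq_nonneg b),
      mul_nonneg (sub_nonneg.2 hn') (sq_nonneg e0), sq_nonneg e0]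
  have h6 : ((4 * (P : ℂ) - 2 * (((P + e0 : ℝ) : ℂ) - Complex.I * b)
      - conj (((P + e0 : ℝ) : ℂ) - Complex.I * b)) * P
      - (2 * P - Complex.I * b) * (n * (((P + e0 : ℝ) : ℂ) - Complex.I * b))).re
      + (2 * n - 2) * ((2 * P - Complex.I * b) * (P : ℂ)).re =
      (2 * n - 3) * P ^ 2 - (2 * n + 3) * (P * e0) + n * b ^ 2 := by
    simp
    ring
  simp only [Complex.sub_re, Complex.add_re, Complex.re_ofReal_mul] at h4 h6 ⊢
  linarith

theorem re_div_cutoff_auxField (hn : 2 ≤ n) {W : SmoothFun n} {w : Heisenberg n → ℝ} {β : ℝ}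
    (hW : IsWeight f e W w β) (hβ : 0 ≤ β) (hβ1 : β ≤ 1) (ψ : SmoothFun n) (p : Heisenberg n)
    {x : ℝ} (hψ : ψ.1 p = x) (hx : 0 ≤ x) {σ ρ K : ℝ} (hσ : 0 < σ) (hρ : 0 < ρ)
    (hK : ∑ α, Complex.normSq ((Lb α ψ).1 p) ≤ K * ρ ^ 2) :
    w p * (x ^ 4 * (gSq f e p / 8 - (2 * n + 3) ^ 2 * (e.1 p).re ^ 2)
        - σ / ρ ^ 2 * (x ^ 6 * jlQuant f e p) - 4 * (512 * K + 94 / σ) ^ 2 * ρ ^ 4)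
      ≤ (∑ α, (Lb α (ψ ^ 4 * W * auxField f α)).1 p).re := by
  refine le_trans ?_ (h.re_div_weighted_auxField he hn hW hβ hβ1 (ψ ^ 4) p (x := x ^ 4)
    (by simp [hψ]) (by positivity))
  refine mul_le_mul_of_nonneg_left ?_ (hW.pos p).le
  set P := gradSqR f p with hP
  set b : ℝ := ((T f).1 p).re with hb
  set S := ∑ α, Complex.normSq ((Lb α ψ).1 p) with hS
  have hP0 : 0 ≤ P := gradSqR_nonneg f p
  have hS0 : 0 ≤ S := Finset.sum_nonneg fun _ _ => Complex.normSq_nonneg _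
  have he0' : 0 < (e.1 p).re := he p
  have h1 := Finset.sum_le_sum fun α (_ : α ∈ Finset.univ) =>
    error_young ((Dv f α).1 p) ((Ev f e α).1 p) ((Gv f e α).1 p) ((L α f).1 p) (x := x) hρ hσ
  have hPsum : ∑ α, Complex.normSq ((L α f).1 p) = P := rfl
  rw [Finset.sum_add_distrib, ← Finset.mul_sum, ← Finset.mul_sum, ← Finset.mul_sum,
    ← Finset.mul_sum, ← vecSq, hPsum] at h1
  have h2 : ∀ α, (auxField f α).1 p * (Lb α (ψ ^ 4)).1 p =
      ((4 * x ^ 3 : ℝ) : ℂ) * ((2 * P - Complex.I * b) * ((L α f).1 p * (Lb α ψ).1 p)) := by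
    intro α
    rw [Derivation.leibniz_pow]
    simp only [auxField, SmoothFun.mul_apply, SmoothFun.sub_apply, SmoothFun.ofNat_apply,
      h.gradSq_apply, iS_apply, hP, smul_eq_mul, nsmul_eq_mul, SmoothFun.natCast_apply,
      SmoothFun.pow_apply, hψ]
    rw [h.T_apply_eq]
    push_cast
    ring
  rw [Finset.sum_congr rfl fun α _ => h2 α, ← Finset.mul_sum, ← Finset.mul_sum,
    Complex.re_ofReal_mul]
  set t := ‖∑ α, (L α f).1 p * (Lb α ψ).1 p‖ with ht
  have ht2 : t ^ 2 ≤ P * S := by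
    rw [ht, ← Complex.normSq_eq_norm_sq]
    exact normSq_sum_mul_le _ _ _
  set B := ‖(2 * P - Complex.I * b : ℂ)‖ with hB
  have hB2 : B ^ 2 ≤ 8 * gSq f e p := by
    rw [hB, ← Complex.normSq_eq_norm_sq, h.gSq_eq, ← hP, ← hb]
    simp [Complex.normSq_apply]
    nlinarith [mul_nonneg hP0 he0'.le, sq_nonneg (e.1 p).re, sq_nonneg b, sq_nonneg P]
  have hPr : P ^ 2 ≤ gSq f e p := by
    rw [h.gSq_eq, ← hP, ← hb]
    nlinarith [mul_nonneg hP0 he0'.le, sq_nonneg (e.1 p).re, sq_nonneg b]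
  have h3 := neg_norm_mul_le_re (2 * P - Complex.I * b : ℂ) (∑ α, (L α f).1 p * (Lb α ψ).1 p)
  rw [← ht, ← hB] at h3
  -- The split x⁴B²/128 + 512 x²t² uses B² ≤ 8|g|² to cost |g|²/16; `h7` costs another |g|²/16,
  -- which lowers 1/4 to 1/8.
  have h4 : -(x ^ 4 * gSq f e p / 16 + 512 * x ^ 2 * (P * S)) ≤ 4 * x ^ 3 * -(B * t) := by
    have e1 : 0 ≤ x ^ 4 * (8 * gSq f e p - B ^ 2) :=
      mul_nonneg (by positivity) (sub_nonneg.2 hB2)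
    have e2 : 0 ≤ x ^ 2 * (P * S - t ^ 2) := mul_nonneg (by positivity) (sub_nonneg.2 ht2)
    nlinarith [sq_nonneg (x ^ 2 * B - 256 * (x * t))]
  have h5 := mul_le_mul_of_nonneg_left h3 (by positivity : 0 ≤ 4 * x ^ 3)
  have h6 : 512 * x ^ 2 * (P * S) ≤ 512 * x ^ 2 * (P * (K * ρ ^ 2)) := by gcongr
  have h7 : 512 * x ^ 2 * (P * (K * ρ ^ 2)) + 94 / σ * ρ ^ 2 * x ^ 2 * P ≤
      x ^ 4 * gSq f e p / 16 + 4 * (512 * K + 94 / σ) ^ 2 * ρ ^ 4 := by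
    have e1 : 0 ≤ x ^ 4 * (gSq f e p - P ^ 2) := mul_nonneg (by positivity) (sub_nonneg.2 hPr)
    nlinarith [sq_nonneg (x ^ 2 * P - 8 * ((512 * K + 94 / σ) * ρ ^ 2))]
  have h8 := mul_le_mul_of_nonneg_left (vecSq_le_jlQuant (f := f) he p)
    (by positivity : 0 ≤ σ * x ^ 6 / ρ ^ 2)
  have h9 : σ / ρ ^ 2 * (x ^ 6 * jlQuant f e p) = σ * x ^ 6 / ρ ^ 2 * jlQuant f e p := by ring
  rw [h9]
  linarith

end IsYamabeLog

/-! ### Integrals of divergences vanish -/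

instance isAddHaarMeasure_volume : (volume : Measure (Heisenberg n)).IsAddHaarMeasure :=
  Measure.prod.instIsAddHaarMeasure (volume : Measure (Fin n → ℂ)) (volume : Measure ℝ)

theorem hasCompactSupport_dirDer (v : Heisenberg n) {F : SmoothFun n}
    (hF : HasCompactSupport F.1) : HasCompactSupport (dirDer v F).1 :=
  (hF.fderiv (𝕜 := ℝ)).comp_left (g := fun A : Heisenberg n →L[ℝ] ℂ => A v) rfl

theorem integral_dirDer (v : Heisenberg n) {F : SmoothFun n} (hF : HasCompactSupport F.1) :
    ∫ p, (dirDer v F).1 p = 0 := by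
  have := integral_mul_fderiv_eq_neg_fderiv_mul_of_integrable (μ := (volume : Measure (Heisenberg n)))
    (f := fun _ : Heisenberg n => (1 : ℂ)) (g := F.1) (v := v)
    (by simp) (by
      simp only [one_mul]
      exact (dirDer v F).continuous.integrable_of_hasCompactSupport
        (hasCompactSupport_dirDer v hF))
    (by simpa using F.continuous.integrable_of_hasCompactSupport hF)
    (fun _ _ => differentiableAt_const _) (fun _ _ => F.differentiable _)
  simp only [one_mul] at this
  refine this.trans ?_
  simp

/-- The coefficient z_α does not depend on t, so Z_ᾱ is divergence free for Lebesgue measure and no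
zero-order term arises in integration by parts. -/
theorem Lb_eq_div (α : Fin n) (F : SmoothFun n) (p : Heisenberg n) : (Lb α F).1 p =
    1 / 2 * (dirDer (Pi.single α 1, 0) F).1 p
      + Complex.I / 2 * (dirDer (Pi.single α Complex.I, 0) F).1 p
      - (dirDer (0, 1) (iS * zS α * F)).1 p := by
  have h0 := T_zS α
  simp only [T] at h0
  rw [der_mul _ (iS * zS α), der_mul _ iS, h0, der_iS]
  simp [Lb, T]
  ring

theorem integral_Lb (α : Fin n) {F : SmoothFun n} (hF : HasCompactSupport F.1) :
    ∫ p, (Lb α F).1 p = 0 := by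
  have hi : ∀ (v : Heisenberg n) {G : SmoothFun n}, HasCompactSupport G.1 →
      Integrable (dirDer v G).1 := fun v G hG =>
    (dirDer v G).continuous.integrable_of_hasCompactSupport (hasCompactSupport_dirDer v hG)
  have hF2 : HasCompactSupport (iS * zS α * F).1 := hF.mul_left
  simp only [Lb_eq_div]
  rw [integral_sub (by exact ((hi _ hF).const_mul _).add ((hi _ hF).const_mul _)) (hi _ hF2),
    integral_add ((hi _ hF).const_mul _) ((hi _ hF).const_mul _), integral_const_mul,
    integral_const_mul, integral_dirDer _ hF, integral_dirDer _ hF, integral_dirDer _ hF2]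
  simp

theorem integral_re_sum_Lb {F : Fin n → SmoothFun n} (hF : ∀ α, HasCompactSupport (F α).1) :
    ∫ p, (∑ α, (Lb α (F α)).1 p).re = 0 := by
  have hi : ∀ α, Integrable (Lb α (F α)).1 := fun α =>
    (Lb α (F α)).continuous.integrable_of_hasCompactSupport (by
      refine HasCompactSupport.intro (hF α).isCompact fun p hp => ?_
      have hd : ∀ v, (dirDer v (F α)).1 p = 0 := fun v => by
        have h1 : fderiv ℝ (F α).1 p = 0 :=
          Function.notMem_support.1 fun h' => hp (support_fderiv_subset ℝ h')
        rw [dirDer_apply, h1]; rfl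
      simp [Lb, T, hd])
  have h1 : ∫ p, ∑ α, (Lb α (F α)).1 p = 0 := by
    rw [integral_finsetSum _ fun α _ => hi α]
    exact Finset.sum_eq_zero fun α _ => integral_Lb α (hF α)
  have h2 := integral_re (𝕜 := ℂ) (integrable_finsetSum Finset.univ fun α _ => hi α)
  simp only [RCLike.re_eq_complex_re] at h2
  rw [h2, h1]; rfl

/-! ### The Korányi gauge, its balls and cutoffs -/

/-- The fourth power `|z|⁴ + t²` of the Korányi gauge. -/
def gauge4 (p : Heisenberg n) : ℝ := sqNorm p.1 ^ 2 + p.2 ^ 2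

/-- The fourth power of the Korányi gauge as a smooth function. -/
def gauge4S : SmoothFun n := (∑ α, zS α * cj (zS α)) ^ 2 + tS ^ 2

theorem sum_zS_apply (p : Heisenberg n) :
    (∑ α, zS α * cj (zS α) : SmoothFun n).1 p = (sqNorm p.1 : ℂ) := by
  simp [sqNorm, Complex.mul_conj, Complex.normSq_eq_norm_sq]

theorem gauge4S_apply (p : Heisenberg n) : (gauge4S : SmoothFun n).1 p = gauge4 p := by
  simp only [gauge4S, SmoothFun.add_apply, SmoothFun.pow_apply, sum_zS_apply, gauge4, tS_apply]
  push_cast; rfl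

theorem Lb_cj_zS (α β : Fin n) : Lb α (cj (zS β)) = if α = β then 1 else 0 := by
  rw [Lb_cj, L_zS]; by_cases h : α = β <;> simp [h]

theorem Lb_sum_zS (α : Fin n) : Lb α (∑ β, zS β * cj (zS β)) = zS α := by
  simp [map_sum, der_mul, Lb_zS, Lb_cj_zS]

theorem Lb_gauge4S (α : Fin n) (p : Heisenberg n) :
    (Lb α gauge4S).1 p = 2 * p.1 α * (sqNorm p.1 - Complex.I * p.2) := by
  rw [gauge4S, map_add, Derivation.leibniz_pow, Derivation.leibniz_pow, Lb_sum_zS, Lb_tS]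
  simp [-SmoothFun.sum_apply, sum_zS_apply]
  ring

theorem sqNorm_nonneg (z : Fin n → ℂ) : 0 ≤ sqNorm z :=
  Finset.sum_nonneg fun _ _ => by positivity

theorem gauge4_nonneg (p : Heisenberg n) : 0 ≤ gauge4 p := by
  rw [gauge4]; positivity

theorem continuous_gauge4 : Continuous (gauge4 : Heisenberg n → ℝ) := by
  unfold gauge4 sqNorm; fun_prop

theorem mem_koranyiBall {R : ℝ} (hR : 0 < R) {p : Heisenberg n} :
    p ∈ koranyiBall n R ↔ gauge4 p < R ^ 4 := by
  rw [koranyiBall, Set.mem_setOf_eq, ← gauge4]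
  have h1 : R = (R ^ 4) ^ (1 / 4 : ℝ) := by
    rw [← Real.rpow_natCast, ← Real.rpow_mul hR.le]; norm_num
  conv_lhs => rw [h1]
  exact Real.rpow_lt_rpow_iff (gauge4_nonneg p) (by positivity) (by norm_num)

theorem isOpen_koranyiBall {R : ℝ} (hR : 0 < R) : IsOpen (koranyiBall n R) := by
  have : koranyiBall n R = {p | gauge4 p < R ^ 4} := by ext p; exact mem_koranyiBall hR
  rw [this]
  exact isOpen_lt continuous_gauge4 continuous_const

theorem koranyiBall_subset {R S : ℝ} (hR : 0 < R) (hRS : R ≤ S) :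
    koranyiBall n R ⊆ koranyiBall n S := fun p hp => by
  rw [mem_koranyiBall hR] at hp
  rw [mem_koranyiBall (hR.trans_le hRS)]
  exact hp.trans_le (by gcongr)

theorem norm_le_of_gauge4_le {R : ℝ} (hR : 0 ≤ R) {p : Heisenberg n} (hp : gauge4 p ≤ R ^ 4) :
    (∀ α, ‖p.1 α‖ ≤ R) ∧ |p.2| ≤ R ^ 2 := by
  rw [gauge4] at hp
  have h1 : sqNorm p.1 ≤ R ^ 2 :=
    (sq_le_sq₀ (sqNorm_nonneg _) (by positivity)).1 (by nlinarith [sq_nonneg p.2])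
  refine ⟨fun α => ?_, abs_le_of_sq_le_sq (by nlinarith [sq_nonneg (sqNorm p.1)]) (by positivity)⟩
  have h2 : ‖p.1 α‖ ^ 2 ≤ sqNorm p.1 :=
    Finset.single_le_sum (f := fun α => ‖p.1 α‖ ^ 2) (fun _ _ => by positivity) (Finset.mem_univ α)
  exact (sq_le_sq₀ (norm_nonneg _) hR).1 (h2.trans h1)

theorem koranyiBall_subset_prod {R : ℝ} (hR : 0 < R) : koranyiBall n R ⊆
    (Set.univ.pi fun _ => Metric.closedBall (0 : ℂ) R) ×ˢ Metric.closedBall (0 : ℝ) (R ^ 2) := by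
  intro p hp
  have := norm_le_of_gauge4_le hR.le ((mem_koranyiBall hR).1 hp).le
  simpa [Set.mem_pi] using this

theorem isCompact_prod (R : ℝ) : IsCompact
    ((Set.univ.pi fun _ : Fin n => Metric.closedBall (0 : ℂ) R) ×ˢ
      Metric.closedBall (0 : ℝ) (R ^ 2)) :=
  (isCompact_univ_pi fun _ => isCompact_closedBall _ _).prod (isCompact_closedBall _ _)

theorem integrableOn_koranyiBall {R : ℝ} (hR : 0 < R) {φ : Heisenberg n → ℝ} (hφ : Continuous φ) :
    IntegrableOn φ (koranyiBall n R) :=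
  (hφ.continuousOn.integrableOn_compact (isCompact_prod R)).mono_set (koranyiBall_subset_prod hR)

/-- A product of discs and an interval already has the scaling R^{2n+2} of the homogeneous
dimension; the sharp constant is irrelevant. -/
theorem volume_koranyiBall_le {R : ℝ} (hR : 0 < R) :
    volume.real (koranyiBall n R) ≤ 2 * Real.pi ^ n * R ^ (2 * n + 2) := by
  have h1 : volume.real ((Set.univ.pi fun _ : Fin n => Metric.closedBall (0 : ℂ) R) ×ˢ
      Metric.closedBall (0 : ℝ) (R ^ 2)) = 2 * Real.pi ^ n * R ^ (2 * n + 2) := by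
    rw [Measure.real, Measure.volume_eq_prod, Measure.prod_prod, volume_pi_pi]
    simp only [Complex.volume_closedBall, Real.volume_closedBall, Finset.prod_const,
      Finset.card_univ, Fintype.card_fin, ENNReal.toReal_mul, ENNReal.toReal_pow,
      ENNReal.toReal_ofReal hR.le, ENNReal.toReal_ofReal (by positivity : 0 ≤ 2 * R ^ 2)]
    simp
    ring
  rw [← h1]
  exact measureReal_mono (koranyiBall_subset_prod hR) (isCompact_prod R).measure_lt_top.ne

/-- The profile of the cutoff functions. -/
def cutoffProfile (s : ℝ) : ℝ := Real.smoothTransition (2 - s)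

theorem contDiff_cutoffProfile : ContDiff ℝ ∞ cutoffProfile :=
  Real.smoothTransition.contDiff.comp (contDiff_const.sub contDiff_id)

theorem cutoffProfile_eq_one {s : ℝ} (h : s ≤ 1) : cutoffProfile s = 1 :=
  Real.smoothTransition.one_of_one_le (by linarith)

theorem cutoffProfile_eq_zero {s : ℝ} (h : 2 ≤ s) : cutoffProfile s = 0 :=
  Real.smoothTransition.zero_of_nonpos (by linarith)

theorem deriv_cutoffProfile_eq_zero {s : ℝ} (h : s < 1 ∨ 2 < s) : deriv cutoffProfile s = 0 := by
  rcases h with h | h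
  · have : cutoffProfile =ᶠ[nhds s] fun _ => 1 := by
      filter_upwards [Iio_mem_nhds h] with x hx using cutoffProfile_eq_one (le_of_lt hx)
    rw [this.deriv_eq]; simp
  · have : cutoffProfile =ᶠ[nhds s] fun _ => 0 := by
      filter_upwards [Ioi_mem_nhds h] with x hx using cutoffProfile_eq_zero (le_of_lt hx)
    rw [this.deriv_eq]; simp

theorem exists_deriv_cutoffProfile_bound : ∃ B, ∀ s, deriv cutoffProfile s ^ 2 ≤ B := by
  have hc : Continuous (deriv cutoffProfile) := contDiff_cutoffProfile.continuous_deriv (by simp)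
  obtain ⟨B, hB⟩ := (isCompact_Icc (a := (1 : ℝ)) (b := 2)).exists_bound_of_continuousOn
    hc.continuousOn
  refine ⟨B ^ 2, fun s => ?_⟩
  by_cases h : s < 1 ∨ 2 < s
  · rw [deriv_cutoffProfile_eq_zero h, zero_pow two_ne_zero]; positivity
  · push Not at h
    rw [← sq_abs]
    exact pow_le_pow_left₀ (abs_nonneg _) (hB s h) 2

/-- A smooth cutoff function, equal to `1` on the Korányi ball of radius `R` and supported in the
ball of radius `2 R`. -/
def cutoff (R : ℝ) : SmoothFun n :=
  ⟨fun p => (cutoffProfile (gauge4 p / R ^ 4) : ℂ), by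
    have h1 : ContDiff ℝ ∞ (gauge4 : Heisenberg n → ℝ) := by
      have : (gauge4 : Heisenberg n → ℝ) = fun p => Complex.reCLM ((gauge4S : SmoothFun n).1 p) := by
        funext p; simp [gauge4S_apply]
      rw [this]
      exact Complex.reCLM.contDiff.comp (SmoothFun.contDiff _)
    exact Complex.ofRealCLM.contDiff.comp
      (contDiff_cutoffProfile.comp (h1.div_const _))⟩

theorem cutoff_apply (R : ℝ) (p : Heisenberg n) :
    (cutoff R).1 p = (cutoffProfile (gauge4 p / R ^ 4) : ℂ) := rfl

theorem Lb_cutoff (R : ℝ) (α : Fin n) (p : Heisenberg n) : (Lb α (cutoff R)).1 p =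
    (deriv cutoffProfile (gauge4 p / R ^ 4) / R ^ 4 : ℝ)
      * (2 * p.1 α * (sqNorm p.1 - Complex.I * p.2)) := by
  rw [← Lb_gauge4S]
  refine Lb_comp_real α (r := gauge4) (φ := fun s => cutoffProfile (s / R ^ 4)) gauge4S_apply
    (fun x => rfl) ?_
  have h1 : HasDerivAt cutoffProfile (deriv cutoffProfile (gauge4 p / R ^ 4)) (gauge4 p / R ^ 4) :=
    (contDiff_cutoffProfile.differentiable (by simp) _).hasDerivAt
  have h2 : HasDerivAt (fun s : ℝ => s / R ^ 4) (1 / R ^ 4) (gauge4 p) :=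
    (hasDerivAt_id _).div_const _
  have h3 := h1.comp (gauge4 p) h2
  rwa [mul_one_div] at h3

theorem Lb_cutoff_eq_zero {R : ℝ} (hR : 0 < R) (α : Fin n) {p : Heisenberg n}
    (hp : p ∈ koranyiBall n R) : (Lb α (cutoff R)).1 p = 0 := by
  rw [mem_koranyiBall hR] at hp
  rw [Lb_cutoff, deriv_cutoffProfile_eq_zero (.inl ((div_lt_one (by positivity)).2 hp))]
  simp

/-- Since Σ|Z_ᾱ(gauge⁴)|² = 4|z|² gauge⁴ is O(R⁶) where the profile varies, division by R⁸ leaves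
R⁻². -/
theorem exists_Lb_cutoff_bound : ∃ K, 0 < K ∧ ∀ R : ℝ, 0 < R → ∀ p : Heisenberg n,
    ∑ α, Complex.normSq ((Lb α (cutoff R)).1 p) ≤ K * R⁻¹ ^ 2 := by
  obtain ⟨B, hB⟩ := exists_deriv_cutoffProfile_bound
  have hB0 : 0 ≤ B := (sq_nonneg _).trans (hB 0)
  -- The extra 1 makes K strictly positive, as later divisions require.
  refine ⟨16 * B + 1, by positivity, fun R hR p => ?_⟩
  have h1 : ∀ α, Complex.normSq ((Lb α (cutoff R)).1 p) =
      deriv cutoffProfile (gauge4 p / R ^ 4) ^ 2 / R ^ 8 * 4 * gauge4 p * ‖p.1 α‖ ^ 2 := by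
    intro α
    rw [Lb_cutoff, Complex.normSq_mul, Complex.normSq_mul, Complex.normSq_mul,
      Complex.normSq_ofReal, Complex.normSq_eq_norm_sq (p.1 α), gauge4]
    simp [Complex.normSq_apply]
    ring
  simp only [h1]
  rw [← Finset.mul_sum, ← sqNorm]
  by_cases h : 2 < gauge4 p / R ^ 4
  · rw [deriv_cutoffProfile_eq_zero (.inr h)]
    rw [zero_pow two_ne_zero, zero_div, zero_mul, zero_mul, zero_mul]
    positivity
  · push Not at h
    have h2 : gauge4 p ≤ 2 * R ^ 4 := (div_le_iff₀ (by positivity)).1 h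
    have h3 : sqNorm p.1 ≤ 2 * R ^ 2 := by
      refine (sq_le_sq₀ (sqNorm_nonneg _) (by positivity)).1 ?_
      rw [gauge4] at h2
      nlinarith [sq_nonneg p.2, pow_pos hR 4]
    have h4 := hB (gauge4 p / R ^ 4)
    have h5 := gauge4_nonneg p
    have h6 := sqNorm_nonneg p.1
    calc deriv cutoffProfile (gauge4 p / R ^ 4) ^ 2 / R ^ 8 * 4 * gauge4 p * sqNorm p.1
        ≤ B / R ^ 8 * 4 * (2 * R ^ 4) * (2 * R ^ 2) := by gcongr
      _ = 16 * B * R⁻¹ ^ 2 := by field_simp; ring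
      _ ≤ _ := by gcongr; linarith

theorem cutoffProfile_mem (s : ℝ) : 0 ≤ cutoffProfile s ∧ cutoffProfile s ≤ 1 :=
  ⟨Real.smoothTransition.nonneg _, Real.smoothTransition.le_one _⟩

theorem cutoff_eq_zero {R : ℝ} (hR : 0 < R) {p : Heisenberg n} (hp : p ∉ koranyiBall n (2 * R)) :
    cutoffProfile (gauge4 p / R ^ 4) = 0 := by
  rw [mem_koranyiBall (by positivity)] at hp
  refine cutoffProfile_eq_zero ((le_div_iff₀ (by positivity)).2 ?_)
  push Not at hp
  nlinarith [pow_pos hR 4]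

theorem cutoff_eq_one {R : ℝ} (hR : 0 < R) {p : Heisenberg n} (hp : p ∈ koranyiBall n R) :
    cutoffProfile (gauge4 p / R ^ 4) = 1 := by
  rw [mem_koranyiBall hR] at hp
  exact cutoffProfile_eq_one ((div_le_one (by positivity)).2 hp.le)

theorem hasCompactSupport_cutoff_mul {R : ℝ} (hR : 0 < R) {k : ℕ} (hk : k ≠ 0)
    (F G : SmoothFun n) : HasCompactSupport ((cutoff R) ^ k * F * G).1 := by
  refine HasCompactSupport.intro (isCompact_prod (2 * R)) fun p hp => ?_
  have h1 : cutoffProfile (gauge4 p / R ^ 4) = 0 :=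
    cutoff_eq_zero hR fun h => hp (koranyiBall_subset_prod (by positivity) h)
  simp [cutoff_apply, h1, hk]

/-- The exponent is at least 2 so that a factor of the cutoff survives differentiation and the
integrand vanishes outside the ball. -/
theorem setIntegral_re_sum_Lb {R : ℝ} (hR : 0 < R) {k : ℕ} (hk : 2 ≤ k) (F : SmoothFun n)
    (G : Fin n → SmoothFun n) :
    ∫ p in koranyiBall n (2 * R), (∑ α, (Lb α ((cutoff R) ^ k * F * G α)).1 p).re = 0 := by
  rw [setIntegral_eq_integral_of_forall_compl_eq_zero,
    integral_re_sum_Lb fun α => hasCompactSupport_cutoff_mul hR (by omega) F (G α)]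
  intro p hp
  have h1 := cutoff_eq_zero hR hp
  obtain ⟨m, rfl⟩ := Nat.exists_eq_add_of_le hk
  have h2 : ∀ α, (Lb α ((cutoff R) ^ (2 + m) * F * G α)).1 p = 0 := by
    intro α
    rw [pow_add, der_mul, der_mul, der_mul, Derivation.leibniz_pow]
    simp [cutoff_apply, h1]
  rw [Finset.sum_eq_zero fun α _ => h2 α, Complex.zero_re]

/-! ### Integral estimates and the vanishing of the Jerison–Lee quantity -/

/-- The cutoff function as a real function. -/
def cutoffR (R : ℝ) (p : Heisenberg n) : ℝ := cutoffProfile (gauge4 p / R ^ 4)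

theorem continuous_cutoffR (R : ℝ) : Continuous (cutoffR R : Heisenberg n → ℝ) :=
  contDiff_cutoffProfile.continuous.comp (continuous_gauge4.div_const _)

theorem continuous_jlQuant (f e : SmoothFun n) : Continuous (jlQuant f e) := by
  have hc : ∀ F : SmoothFun n, Continuous fun p => Complex.normSq (F.1 p) := fun F =>
    Complex.continuous_normSq.comp F.continuous
  have h1 : Continuous (vecSq f e) := by
    refine continuous_finsetSum _ fun α _ => ?_
    exact (((hc (Gv f e α)).add (hc (Gv f e α + Dv f α))).add (hc (Gv f e α - Ev f e α))).add
      (hc (Dv f α + Ev f e α))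
  have h2 : Continuous (tensorSq f e) :=
    continuous_finsetSum _ fun α _ => continuous_finsetSum _ fun β _ =>
      (hc (Dt f α β)).add (hc (Et f e α β))
  exact h1.add ((Complex.continuous_re.comp e.continuous).mul h2)

theorem continuous_gSq (f e : SmoothFun n) : Continuous (gSq f e) :=
  Complex.continuous_normSq.comp (gS f e).continuous

theorem IsWeight.continuous {f e W : SmoothFun n} {w : Heisenberg n → ℝ} {β : ℝ}
    (hW : IsWeight f e W w β) : Continuous w := by
  have : w = fun p => (W.1 p).re := by funext p; rw [hW.apply_eq]; rfl
  rw [this]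
  exact Complex.continuous_re.comp W.continuous

theorem continuous_re_sum_Lb (F : Fin n → SmoothFun n) :
    Continuous fun p => (∑ α, (Lb α (F α)).1 p).re :=
  Complex.continuous_re.comp (continuous_finsetSum _ fun α _ => (Lb α (F α)).continuous)

namespace IsYamabeLog
variable {f e : SmoothFun n} (h : IsYamabeLog f e) (he : ∀ p, 0 < (e.1 p).re)
  {W : SmoothFun n} {w : Heisenberg n → ℝ} {β : ℝ} (hW : IsWeight f e W w β)
include h he hW

theorem jlQuant_integral_le (hβ : 0 ≤ β) {K R τ : ℝ}
    (hK : ∀ p : Heisenberg n, ∑ α, Complex.normSq ((Lb α (cutoff R)).1 p) ≤ K * R⁻¹ ^ 2)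
    (hR : 0 < R) (hτ : 0 < τ) :
    (1 - β - τ) * ∫ p in koranyiBall n (2 * R), cutoffR R p ^ 6 * jlQuant f e p * w p ≤
      1215 / τ * K * R⁻¹ ^ 2 *
        ∫ p in koranyiBall n (2 * R), cutoffR R p ^ 4 * gSq f e p * w p := by
  have hR2 : 0 < 2 * R := by positivity
  have c1 := continuous_cutoffR (n := n) R
  have c2 := continuous_jlQuant f e
  have c3 := continuous_gSq f e
  have c4 := hW.continuous
  have h0 := setIntegral_re_sum_Lb hR (k := 6) (by norm_num) W (jlField f e)
  rw [← sub_nonpos, ← integral_const_mul, ← integral_const_mul,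
    ← integral_sub (integrableOn_koranyiBall hR2 (by fun_prop))
      (integrableOn_koranyiBall hR2 (by fun_prop)), ← h0]
  refine integral_mono (integrableOn_koranyiBall hR2 (by fun_prop))
    (integrableOn_koranyiBall hR2 (continuous_re_sum_Lb _)) fun p => ?_
  refine le_trans ?_ (h.re_div_cutoff_jlField he hW hβ (cutoff R) p (x := cutoffR R p) rfl
    (cutoffProfile_mem _).1 hτ)
  have h1 := mul_le_mul_of_nonneg_left (hK p) (a := 1215 / τ * gSq f e p * cutoffR R p ^ 4)
    (by have := (h.gSq_pos he p).le; positivity)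
  have h2 := mul_le_mul_of_nonneg_left h1 (hW.pos p).le
  simp only
  linarith

/-- On the inner ball the cutoff has zero gradient, so Young's inequality is needed only on the
annulus. The term with τ is thus charged to the annulus alone and τ may be arbitrarily large. -/
theorem jlQuant_integral_le_annulus (hβ : 0 ≤ β) {K R τ : ℝ}
    (hK : ∀ p : Heisenberg n, ∑ α, Complex.normSq ((Lb α (cutoff R)).1 p) ≤ K * R⁻¹ ^ 2)
    (hK0 : 0 ≤ K) (hR : 0 < R) (hτ : 0 < τ) :
    (1 - β) * ∫ p in koranyiBall n (2 * R), cutoffR R p ^ 6 * jlQuant f e p * w p ≤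
      τ * ((∫ p in koranyiBall n (2 * R), jlQuant f e p * w p)
        - ∫ p in koranyiBall n R, jlQuant f e p * w p) + 1215 / τ * K * R⁻¹ ^ 2 *
        ∫ p in koranyiBall n (2 * R), cutoffR R p ^ 4 * gSq f e p * w p := by
  have hR2 : 0 < 2 * R := by positivity
  have c1 := continuous_cutoffR (n := n) R
  have c2 := continuous_jlQuant f e
  have c3 := continuous_gSq f e
  have c4 := hW.continuous
  have hi : IntegrableOn (fun p => jlQuant f e p * w p) (koranyiBall n (2 * R)) :=
    integrableOn_koranyiBall hR2 (c2.mul c4)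
  have h0 := setIntegral_re_sum_Lb hR (k := 6) (by norm_num) W (jlField f e)
  have hsub := koranyiBall_subset (n := n) hR (by linarith : R ≤ 2 * R)
  have hm := (isOpen_koranyiBall (n := n) hR).measurableSet
  have h3 := integral_diff hm hi hsub
  rw [← h3]
  set A := koranyiBall n (2 * R) \ koranyiBall n R with hA
  have hmA : MeasurableSet A := (isOpen_koranyiBall hR2).measurableSet.diff hm
  have h4 : ∫ p in A, jlQuant f e p * w p =
      ∫ p in koranyiBall n (2 * R), A.indicator (fun p => jlQuant f e p * w p) p := by
    rw [setIntegral_indicator hmA, Set.inter_eq_self_of_subset_right Set.diff_subset]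
  have hiA : IntegrableOn (A.indicator (fun p => jlQuant f e p * w p)) (koranyiBall n (2 * R)) :=
    hi.indicator hmA
  rw [h4, ← sub_nonpos, ← integral_const_mul, ← integral_const_mul, ← integral_const_mul,
    ← integral_add (hiA.const_mul _) (integrableOn_koranyiBall hR2 (by fun_prop)),
    ← integral_sub (integrableOn_koranyiBall hR2 (by fun_prop))
      (by exact (hiA.const_mul _).add (integrableOn_koranyiBall hR2 (by fun_prop))), ← h0]
  refine setIntegral_mono_on ((integrableOn_koranyiBall hR2 (by fun_prop)).sub
    ((hiA.const_mul _).add (integrableOn_koranyiBall hR2 (by fun_prop))))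
    (integrableOn_koranyiBall hR2 (continuous_re_sum_Lb _))
    (isOpen_koranyiBall hR2).measurableSet fun p hp => ?_
  have hg := (h.gSq_pos he p).le
  have hj := jlQuant_nonneg (f := f) he p
  have hw := (hW.pos p).le
  have hx := cutoffProfile_mem (gauge4 p / R ^ 4)
  change 0 ≤ cutoffR R p ∧ cutoffR R p ≤ 1 at hx
  by_cases hpR : p ∈ koranyiBall n R
  · refine le_trans ?_ (h.re_div_weighted_jlField he hW hβ (cutoff R ^ 6) p
      (x := cutoffR R p ^ 6) (by simp [cutoff_apply, cutoffR]) (by have := hx.1; positivity))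
    have h5 : ∀ α, (Lb α (cutoff R ^ 6)).1 p = 0 := fun α => by
      rw [Derivation.leibniz_pow]; simp [Lb_cutoff_eq_zero hR α hpR]
    have h6 : A.indicator (fun p => jlQuant f e p * w p) p = 0 :=
      Set.indicator_of_notMem (fun hq => hq.2 hpR) _
    simp only [h5, h6, mul_zero, Finset.sum_const_zero, Complex.zero_re, add_zero, zero_add]
    have : 0 ≤ 1215 / τ * K * R⁻¹ ^ 2 * (cutoffR R p ^ 4 * gSq f e p * w p) := by positivity
    linarith
  · refine le_trans ?_ (h.re_div_cutoff_jlField he hW hβ (cutoff R) p (x := cutoffR R p) rfl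
      hx.1 hτ)
    have h6 : A.indicator (fun p => jlQuant f e p * w p) p = jlQuant f e p * w p :=
      Set.indicator_of_mem (show p ∈ A from ⟨hp, hpR⟩) _
    have h1 := mul_le_mul_of_nonneg_left (hK p) (a := 1215 / τ * gSq f e p * cutoffR R p ^ 4)
      (by positivity)
    have h2 := mul_le_mul_of_nonneg_left h1 hw
    have h7 : cutoffR R p ^ 6 * jlQuant f e p ≤ jlQuant f e p :=
      mul_le_of_le_one_left hj (pow_le_one₀ hx.1 hx.2)
    have h8 := mul_le_mul_of_nonneg_left h7 (mul_nonneg hw hτ.le)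
    simp only [h6]
    linarith

theorem gSq_integral_le (hn : 2 ≤ n) (hβ : 0 ≤ β) (hβ1 : β ≤ 1) {K R σ : ℝ}
    (hK : ∀ p : Heisenberg n, ∑ α, Complex.normSq ((Lb α (cutoff R)).1 p) ≤ K * R⁻¹ ^ 2)
    (hR : 0 < R) (hσ : 0 < σ) :
    (∫ p in koranyiBall n (2 * R), cutoffR R p ^ 4 * gSq f e p * w p) ≤
      8 * ((2 * n + 3) ^ 2 + 4 * (512 * K + 94 / σ) ^ 2) *
        (∫ p in koranyiBall n (2 * R), ((e.1 p).re ^ 2 + R⁻¹ ^ 4) * w p)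
      + 8 * σ * R ^ 2 *
        ∫ p in koranyiBall n (2 * R), cutoffR R p ^ 6 * jlQuant f e p * w p := by
  have hR2 : 0 < 2 * R := by positivity
  have c1 := continuous_cutoffR (n := n) R
  have c2 := continuous_jlQuant f e
  have c3 := continuous_gSq f e
  have c4 := hW.continuous
  have c5 : Continuous fun p => (e.1 p).re := Complex.continuous_re.comp e.continuous
  have h0 := setIntegral_re_sum_Lb hR (k := 4) (by norm_num) W (auxField f)
  rw [← sub_nonpos, ← integral_const_mul, ← integral_const_mul,
    ← integral_add (integrableOn_koranyiBall hR2 (by fun_prop))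
      (integrableOn_koranyiBall hR2 (by fun_prop)),
    ← integral_sub (integrableOn_koranyiBall hR2 (by fun_prop))
      (integrableOn_koranyiBall hR2 (by fun_prop))]
  have h8 := integral_const_mul (μ := volume.restrict (koranyiBall n (2 * R))) (8 : ℝ)
    fun p => (∑ α, (Lb α (cutoff R ^ 4 * W * auxField f α)).1 p).re
  rw [h0, mul_zero] at h8
  rw [← h8]
  refine integral_mono (integrableOn_koranyiBall hR2 (by fun_prop))
    ((integrableOn_koranyiBall hR2 (continuous_re_sum_Lb _)).const_mul 8) fun p => ?_
  have hx := cutoffProfile_mem (gauge4 p / R ^ 4)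
  change 0 ≤ cutoffR R p ∧ cutoffR R p ≤ 1 at hx
  refine le_trans ?_ (mul_le_mul_of_nonneg_left (h.re_div_cutoff_auxField he hn hW hβ hβ1 (cutoff R)
    p (x := cutoffR R p) rfl hx.1 hσ (inv_pos.2 hR) (hK p)) (by norm_num : (0 : ℝ) ≤ 8))
  have hw := (hW.pos p).le
  have h1 : cutoffR R p ^ 4 ≤ 1 := pow_le_one₀ hx.1 hx.2
  have h2 := mul_le_mul_of_nonneg_right h1
    (a := (8 * (2 * (n : ℝ) + 3) ^ 2 * (e.1 p).re ^ 2) * w p) (by positivity)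
  have h3 : 0 ≤ 8 * (2 * (n : ℝ) + 3) ^ 2 * R⁻¹ ^ 4 * w p := by positivity
  have h4 : 0 ≤ 8 * (4 * (512 * K + 94 / σ) ^ 2) * (e.1 p).re ^ 2 * w p := by positivity
  have h5 : σ / R⁻¹ ^ 2 = σ * R ^ 2 := by field_simp
  rw [h5]
  simp only
  linarith

theorem jlQuant_eq_zero (hn : 2 ≤ n) (hβ : 0 ≤ β) (hβ1 : β < 1)
    (hH : ∃ A, ∀ R : ℝ, 1 < R →
      ∫ p in koranyiBall n (2 * R), ((e.1 p).re ^ 2 + R⁻¹ ^ 4) * w p ≤ A * R ^ 2)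
    (p : Heisenberg n) : jlQuant f e p = 0 := by
  obtain ⟨A, hA⟩ := hH
  obtain ⟨K, hK0, hK⟩ := exists_Lb_cutoff_bound (n := n)
  set m : ℝ → ℝ := fun R => ∫ p in koranyiBall n R, jlQuant f e p * w p with hm
  have c1 := fun R => continuous_cutoffR (n := n) R
  have c2 := continuous_jlQuant f e
  have c4 := hW.continuous
  have hnn : ∀ p, 0 ≤ jlQuant f e p * w p := fun p =>
    mul_nonneg (jlQuant_nonneg (f := f) he p) (hW.pos p).le
  have hβ2 : 0 < 1 - β := by linarith
  obtain ⟨B, hB0, hB⟩ : ∃ B, 0 ≤ B ∧ ∀ R : ℝ, 1 < R →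
      (∫ p in koranyiBall n (2 * R), cutoffR R p ^ 4 * gSq f e p * w p) ≤ B * R ^ 2 := by
    set C1 := (2 / (1 - β)) * (1215 / ((1 - β) / 2) * K) with hC1
    have hC1p : 0 < C1 := by positivity
    -- With 8σC₁ = 1/2, the two integral estimates combine so that half of the |g|² integral is
    -- absorbed.
    set σ := 1 / (16 * C1) with hσ
    have hσ0 : 0 < σ := by positivity
    set N := 8 * ((2 * (n : ℝ) + 3) ^ 2 + 4 * (512 * K + 94 / σ) ^ 2) with hN
    have hN0 : 0 ≤ N := by positivity
    refine ⟨2 * (N * |A|), by positivity, fun R hR => ?_⟩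
    have hR0 : 0 < R := by linarith
    have h1 := h.jlQuant_integral_le he hW hβ (hK R hR0) hR0 (half_pos hβ2)
    have h2 := h.gSq_integral_le he hW hn hβ hβ1.le (hK R hR0) hR0 hσ0
    rw [← hN] at h2
    set I := ∫ p in koranyiBall n (2 * R), cutoffR R p ^ 6 * jlQuant f e p * w p
    set J := ∫ p in koranyiBall n (2 * R), cutoffR R p ^ 4 * gSq f e p * w p
    have h3 : I ≤ C1 * R⁻¹ ^ 2 * J := by
      have h4 : (1 - β - (1 - β) / 2) * I = (1 - β) / 2 * I := by ring
      rw [h4] at h1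
      have h5 := mul_le_mul_of_nonneg_left h1 (by positivity : 0 ≤ 2 / (1 - β))
      have h6 : 2 / (1 - β) * ((1 - β) / 2 * I) = I := by field_simp
      rw [h6] at h5
      refine h5.trans_eq ?_
      rw [hC1]; ring
    have h7 := mul_le_mul_of_nonneg_left h3 (by positivity : 0 ≤ 8 * σ * R ^ 2)
    have h8 : 8 * σ * R ^ 2 * (C1 * R⁻¹ ^ 2 * J) = J / 2 := by
      rw [hσ]; field_simp; ring
    have h9 := mul_le_mul_of_nonneg_left ((hA R hR).trans
      (mul_le_mul_of_nonneg_right (le_abs_self A) (by positivity))) hN0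
    linarith
  have hmono : ∀ {R S : ℝ}, 0 < R → R ≤ S → m R ≤ m S := fun {R S} hR hRS =>
    setIntegral_mono_set (integrableOn_koranyiBall (hR.trans_le hRS) (c2.mul c4))
      (Eventually.of_forall hnn) (koranyiBall_subset hR hRS).eventuallyLE
  have hmI : ∀ R : ℝ, 0 < R →
      m R ≤ ∫ p in koranyiBall n (2 * R), cutoffR R p ^ 6 * jlQuant f e p * w p := by
    intro R hR
    have hnn' : ∀ p : Heisenberg n, 0 ≤ cutoffR R p ^ 6 * jlQuant f e p * w p := fun p => by
      rw [mul_assoc]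
      exact mul_nonneg (pow_nonneg (cutoffProfile_mem _).1 _) (hnn p)
    calc m R = ∫ p in koranyiBall n R, cutoffR R p ^ 6 * jlQuant f e p * w p :=
          setIntegral_congr_fun (isOpen_koranyiBall hR).measurableSet fun p hp => by
            simp only [cutoffR, cutoff_eq_one hR hp, one_pow, one_mul]
      _ ≤ _ := setIntegral_mono_set
          (integrableOn_koranyiBall (by positivity) ((((c1 R).pow 6).mul c2).mul c4))
          (Eventually.of_forall hnn') (koranyiBall_subset hR (by linarith)).eventuallyLE
  have hmain : ∀ R : ℝ, 1 < R → ∀ τ : ℝ, 0 < τ →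
      (1 - β) * m R ≤ τ * (m (2 * R) - m R) + 1215 / τ * K * B := by
    intro R hR τ hτ
    have hR0 : 0 < R := by linarith
    have h1 := h.jlQuant_integral_le_annulus he hW hβ (hK R hR0) hK0.le hR0 hτ
    have h2 := mul_le_mul_of_nonneg_left (hmI R hR0) hβ2.le
    have h3 := mul_le_mul_of_nonneg_left (hB R hR)
      (by positivity : 0 ≤ 1215 / τ * K * R⁻¹ ^ 2)
    have h4 : 1215 / τ * K * R⁻¹ ^ 2 * (B * R ^ 2) = 1215 / τ * K * B := by field_simp
    linarith
  have hbdd : ∀ R : ℝ, 1 < R → (1 - β) / 2 * m R ≤ 1215 / ((1 - β) / 2) * K * B := by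
    intro R hR
    have hR0 : 0 < R := by linarith
    have h1 := h.jlQuant_integral_le he hW hβ (hK R hR0) hR0 (half_pos hβ2)
    have h2 := mul_le_mul_of_nonneg_left (hmI R hR0) (half_pos hβ2).le
    have h3 := mul_le_mul_of_nonneg_left (hB R hR)
      (by positivity : 0 ≤ 1215 / ((1 - β) / 2) * K * R⁻¹ ^ 2)
    have h4 : 1215 / ((1 - β) / 2) * K * R⁻¹ ^ 2 * (B * R ^ 2) = 1215 / ((1 - β) / 2) * K * B := by
      field_simp
    rw [h4] at h3
    have h5 : (1 - β - (1 - β) / 2) = (1 - β) / 2 := by ring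
    rw [h5] at h1
    linarith
  have hzero : ∀ R : ℝ, 1 < R → m R = 0 := by
    intro R hR
    -- Along dyadic radii the masses increase to a finite limit Λ, so the annular differences tend
    -- to 0.
    set s : ℕ → ℝ := fun k => m (2 ^ k * R) with hs
    have hRk : ∀ k : ℕ, 1 < 2 ^ k * R := fun k =>
      one_lt_mul_of_le_of_lt (one_le_pow₀ (by norm_num)) hR
    have hsm : Monotone s := monotone_nat_of_le_succ fun k => by
      refine hmono (by linarith [hRk k]) ?_
      rw [pow_succ]
      nlinarith [hRk k]
    have hsb : BddAbove (Set.range s) := by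
      refine ⟨1215 / ((1 - β) / 2) * K * B / ((1 - β) / 2), ?_⟩
      rintro _ ⟨k, rfl⟩
      rw [le_div_iff₀ (half_pos hβ2), mul_comm]
      exact hbdd _ (hRk k)
    have hlim := tendsto_atTop_ciSup hsm hsb
    set Λ := ⨆ k, s k
    have hlim' : Tendsto (fun k => s (k + 1)) atTop (𝓝 Λ) := (tendsto_add_atTop_iff_nat 1).2 hlim
    have h1 : ∀ τ : ℝ, 0 < τ → (1 - β) * Λ ≤ 1215 / τ * K * B := by
      intro τ hτ
      have h2 : Tendsto (fun k => τ * (s (k + 1) - s k) + 1215 / τ * K * B) atTop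
          (𝓝 (τ * (Λ - Λ) + 1215 / τ * K * B)) :=
        ((hlim'.sub hlim).const_mul τ).add_const _
      have h3 := le_of_tendsto_of_tendsto' (hlim.const_mul (1 - β)) h2 fun k => by
        have := hmain _ (hRk k) τ hτ
        have h4 : 2 * (2 ^ k * R) = 2 ^ (k + 1) * R := by ring
        rwa [h4] at this
      simpa using h3
    -- Here τ tends to infinity; the annular term has already disappeared in the limit over k.
    have h2 : (1 - β) * Λ ≤ 0 := by
      have h3 : Tendsto (fun τ : ℝ => 1215 / τ * K * B) atTop (𝓝 0) := by
        have := ((tendsto_const_nhds (x := (1215 : ℝ))).div_atTop tendsto_id).mul_const (K * B)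
        simpa [mul_assoc] using this
      exact ge_of_tendsto h3 ((eventually_gt_atTop 0).mono h1)
    have h3 : s 0 ≤ Λ := le_ciSup hsb 0
    have h4 : s 0 = m R := by simp [hs]
    have h5 : 0 ≤ m R := integral_nonneg hnn
    have h6 : Λ ≤ 0 := by
      by_contra hcon
      push Not at hcon
      nlinarith
    linarith
  -- Any R > 1 with gauge⁴ < R⁴ serves; on that open ball continuity upgrades almost everywhere
  -- vanishing to vanishing at the point.
  set R := gauge4 p + 2 with hRdef
  have hg := gauge4_nonneg p
  have hR : 1 < R := by linarith
  have hR0 : 0 < R := by linarith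
  have hp : p ∈ koranyiBall n R := by
    rw [mem_koranyiBall hR0]
    nlinarith [pow_pos hR0 3, one_lt_pow₀ hR (n := 3) (by norm_num)]
  have h1 := (setIntegral_eq_zero_iff_of_nonneg_ae (Eventually.of_forall hnn)
    (integrableOn_koranyiBall hR0 (c2.mul c4))).1 (hzero R hR)
  have h2 := Measure.eqOn_open_of_ae_eq h1 (isOpen_koranyiBall hR0) (c2.mul c4).continuousOn
    continuousOn_const hp
  exact (mul_eq_zero.1 h2).resolve_right (hW.pos p).ne'

end IsYamabeLog

/-! ### Rigidity when the quantity vanishes, and construction of the weight -/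

/-- A smooth real function as a smooth complex function. -/
def ofRealFun (r : Heisenberg n → ℝ) (hr : ContDiff ℝ ∞ r) : SmoothFun n :=
  ⟨fun p => (r p : ℂ), Complex.ofRealCLM.contDiff.comp hr⟩

@[simp] theorem ofRealFun_apply (r : Heisenberg n → ℝ) (hr : ContDiff ℝ ∞ r) (p : Heisenberg n) :
    (ofRealFun r hr).1 p = r p := rfl

theorem cj_ofRealFun (r : Heisenberg n → ℝ) (hr : ContDiff ℝ ∞ r) :
    cj (ofRealFun r hr) = ofRealFun r hr := by ext p; simp

theorem L_comp_real (α : Fin n) {r : Heisenberg n → ℝ} {F G : SmoothFun n}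
    {φ : ℝ → ℝ} {φ' : ℝ} {p : Heisenberg n} (hr : ∀ x, F.1 x = r x)
    (hG : ∀ x, G.1 x = φ (r x)) (hφ : HasDerivAt φ φ' (r p)) :
    (L α G).1 p = φ' * (L α F).1 p := by
  simp only [L, T, Derivation.add_apply, Derivation.smul_apply, Derivation.sub_apply,
    smul_eq_mul, SmoothFun.mul_apply, SmoothFun.sub_apply, SmoothFun.add_apply,
    dirDer_comp_real _ hr hG hφ]
  ring

theorem L_sum_zS (α : Fin n) : L α (∑ β, zS β * cj (zS β)) = cj (zS α) := by
  simp [map_sum, der_mul, L_zS, L_cj, Lb_zS]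

theorem T_sum_zS : T (∑ β, zS β * cj (zS β) : SmoothFun n) = 0 := by
  simp [map_sum, der_mul, T_cj, T_zS]

/-- The logarithm of the weight `|g|^{-β} exp ((2n-2+β) f)`. -/
def logWeight (f e : SmoothFun n) (β : ℝ) (p : Heisenberg n) : ℝ :=
  (2 * n - 2 + β) * (f.1 p).re - β / 2 * Real.log (gSq f e p)

theorem contDiff_gSq (f e : SmoothFun n) : ContDiff ℝ ∞ (gSq f e) := by
  have : gSq f e = fun p => Complex.reCLM ((gS f e * cj (gS f e)).1 p) := by
    funext p; simp [gSq, Complex.normSq_apply]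
  rw [this]
  exact Complex.reCLM.contDiff.comp (SmoothFun.contDiff _)

namespace IsYamabeLog
variable {f e : SmoothFun n} (h : IsYamabeLog f e) (he : ∀ p, 0 < (e.1 p).re)
include h he

omit h in
theorem tensors_eq_zero (h0 : ∀ p, jlQuant f e p = 0) :
    (∀ α β, Dt f α β = 0) ∧ (∀ α β, Et f e α β = 0) ∧ ∀ α, Gv f e α = 0 := by
  have h1 : ∀ p, vecSq f e p = 0 := fun p =>
    le_antisymm ((vecSq_le_jlQuant (f := f) he p).trans (h0 p).le) (vecSq_nonneg f e p)
  have h2 : ∀ p, tensorSq f e p = 0 := fun p => by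
    have := h0 p
    rw [jlQuant, h1, zero_add] at this
    exact (mul_eq_zero.1 this).resolve_left (he p).ne'
  have h3 : ∀ p α β, Complex.normSq ((Dt f α β).1 p) + Complex.normSq ((Et f e α β).1 p) = 0 := by
    intro p α β
    have h4 := (Finset.sum_eq_zero_iff_of_nonneg fun α _ => Finset.sum_nonneg fun β _ =>
      add_nonneg (Complex.normSq_nonneg _) (Complex.normSq_nonneg _)).1 (h2 p) α (Finset.mem_univ _)
    exact (Finset.sum_eq_zero_iff_of_nonneg fun β _ =>
      add_nonneg (Complex.normSq_nonneg _) (Complex.normSq_nonneg _)).1 h4 β (Finset.mem_univ _)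
  refine ⟨fun α β => ?_, fun α β => ?_, fun α => ?_⟩
  · ext p
    have := h3 p α β
    exact Complex.normSq_eq_zero.1 (by
      linarith [Complex.normSq_nonneg ((Dt f α β).1 p), Complex.normSq_nonneg ((Et f e α β).1 p)])
  · ext p
    have := h3 p α β
    exact Complex.normSq_eq_zero.1 (by
      linarith [Complex.normSq_nonneg ((Dt f α β).1 p), Complex.normSq_nonneg ((Et f e α β).1 p)])
  · ext p
    have h4 := (Finset.sum_eq_zero_iff_of_nonneg fun α _ => vecTerm_nonneg _ _ _).1 (h1 p) α
      (Finset.mem_univ _)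
    simp only [vecTerm] at h4
    have := Complex.normSq_nonneg
    exact Complex.normSq_eq_zero.1 (by
      linarith [this ((Gv f e α).1 p), this ((Gv f e α).1 p + (Dv f α).1 p),
        this ((Gv f e α).1 p - (Ev f e α).1 p), this ((Dv f α).1 p + (Ev f e α).1 p)])

theorem gS_ne_zero (p : Heisenberg n) : (gS f e).1 p ≠ 0 :=
  Complex.normSq_pos.1 (h.gSq_pos he p)

theorem exists_affine_of_jlQuant_eq_zero (hn : 0 < n) (h0 : ∀ p, jlQuant f e p = 0) :
    ∃ (μ : Fin n → ℂ) (lam : ℂ), ∀ p : Heisenberg n,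
      0 < ‖(p.2 : ℂ) + Complex.I * (sqNorm p.1 : ℂ) + herm μ p.1 + lam‖ ∧
      ‖(p.2 : ℂ) + Complex.I * (sqNorm p.1 : ℂ) + herm μ p.1 + lam‖ ^ 2 * (4 * (e.1 p).re) =
        4 * lam.im - sqNorm μ := by
  obtain ⟨hD, hE, hG⟩ := tensors_eq_zero (f := f) he h0
  have hDv : ∀ α, Dv f α = 0 := fun α => by simp [Dv, hD]
  have hEv : ∀ α, Ev f e α = 0 := fun α => by simp [Ev, hE]
  have hLg : ∀ α, L α (gS f e) = 2 * (gS f e * L α f) := fun α => by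
    rw [h.L_gS, hDv, hEv, hG]; ring
  have hLbg : ∀ α, Lb α (gS f e) = 0 := fun α => by rw [h.Lb_gS, hDv, hEv, hG]; simp
  obtain ⟨gi, hgi⟩ : ∃ gi : SmoothFun n, gi * gS f e = 1 := by
    refine ⟨⟨fun p => ((gS f e).1 p)⁻¹, (gS f e).contDiff.inv (h.gS_ne_zero he)⟩, ?_⟩
    ext p
    exact inv_mul_cancel₀ (h.gS_ne_zero he p)
  have hgi' : ∀ d : Derivation ℂ (SmoothFun n) (SmoothFun n), d gi = -(gi * gi * d (gS f e)) := by
    intro d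
    have h1 : d gi * gS f e + gi * d (gS f e) = 0 := by rw [← der_mul, hgi, d.map_one_eq_zero]
    linear_combination gi * h1 - d gi * hgi
  -- For an extremal, ζ = i/g turns out to be the function t + i|z|² + ⟨μ, z⟩ + λ in the
  -- denominator.
  obtain ⟨ζ, hζ⟩ : ∃ ζ : SmoothFun n, ζ = iS * gi := ⟨_, rfl⟩
  have hζg : ζ * gS f e = iS := by rw [hζ, mul_assoc, hgi, mul_one]
  have hLζ : ∀ α, L α ζ = -(2 * (ζ * L α f)) := fun α => by
    rw [hζ, der_mul, der_iS, hgi', hLg]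
    linear_combination (-2 * iS * gi * L α f) * hgi
  have hLbζ : ∀ α, Lb α ζ = 0 := fun α => by
    rw [hζ, der_mul, der_iS, hgi', hLbg]; ring
  -- Apply the commutator [Z_α, Z_ᾱ] = -2i ∂_t to ζ for one index α, using Z_ᾱ ζ = 0 and f_{αᾱ} =
  -- -g; n > 0 supplies the index.
  have hTζ : T ζ = 1 := by
    have h1 := L_Lb ⟨0, hn⟩ ⟨0, hn⟩ ζ
    have h2 := h.Lb_L ⟨0, hn⟩ ⟨0, hn⟩
    rw [hE] at h2
    rw [hLbζ, map_zero, hLζ, map_neg, der_two_mul, der_mul, hLbζ, h2] at h1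
    simp only [if_true] at h1
    have h3 : iS * T ζ = iS := by
      have h4 : (2 : SmoothFun n) * (iS * T ζ) = 2 * iS := by linear_combination h1 + 2 * hζg
      have h5 := congrArg (fun F : SmoothFun n => const (1 / 2) * F) h4
      ext p
      have h6 := congrArg (fun F : SmoothFun n => F.1 p) h5
      simpa using h6
    linear_combination (-iS) * h3 + (T ζ - 1) * iS_sq (n := n)
  obtain ⟨F, hF⟩ : ∃ F : SmoothFun n, F = ζ - tS - iS * ∑ β, zS β * cj (zS β) := ⟨_, rfl⟩
  have hLF : ∀ α, L α F = L α ζ - 2 * (iS * cj (zS α)) := fun α => by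
    rw [hF, map_sub, map_sub, der_mul, der_iS, L_tS, L_sum_zS]; ring
  have hLbF : ∀ α, Lb α F = 0 := fun α => by
    rw [hF, map_sub, map_sub, der_mul, der_iS, Lb_tS, Lb_sum_zS, hLbζ]; ring
  have hTF : T F = 0 := by
    rw [hF, map_sub, map_sub, der_mul, der_iS, T_tS, T_sum_zS, hTζ]; ring
  -- Z_β Z_α ζ = 4ζ f_α f_β - 2ζ f_{αβ} vanishes because D = 0; the Z_β̄-derivative vanishes by the
  -- commutator, as ∂_t F = 0.
  have hconst : ∀ α, ∃ c : ℂ, ∀ p, (L α F).1 p = c := by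
    intro α
    refine eq_const_of_der_eq_zero (fun β => ?_) (fun β => ?_) (by rw [T_L, hTF, map_zero])
    · rw [hLF, map_sub, der_two_mul, der_mul, der_iS, L_cj, Lb_zS, map_zero, hLζ, map_neg,
        der_two_mul, der_mul, hLζ, L_L_eq, hD]
      ring
    · have h1 := L_Lb α β F
      rw [hLbF, map_zero, hTF] at h1
      simpa using h1.symm
  choose k hk using hconst
  have hLbk : ∀ α, L α F = const (k α) := fun α => by ext p; exact hk α p
  obtain ⟨lam, hlam⟩ := eq_const_of_der_eq_zero (F := F - ∑ β, const (k β) * zS β)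
    (fun α => by
      rw [map_sub, hLbk, map_sum]
      simp [der_mul, L_zS])
    (fun α => by
      rw [map_sub, hLbF, map_sum]
      simp [der_mul, Lb_zS])
    (by
      rw [map_sub, hTF, map_sum]
      simp [der_mul, T_zS])
  refine ⟨fun α => conj (k α), lam, fun p => ?_⟩
  set H := herm (fun α => conj (k α)) p.1 with hH
  have hH' : H = ∑ β, k β * p.1 β := by simp [hH, herm]
  have hζp : ζ.1 p = (p.2 : ℂ) + Complex.I * (sqNorm p.1 : ℂ) + H + lam := by
    have h1 := hlam p
    rw [SmoothFun.sub_apply, hF, SmoothFun.sub_apply, SmoothFun.sub_apply, SmoothFun.mul_apply,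
      sum_zS_apply] at h1
    simp only [SmoothFun.sum_apply, SmoothFun.mul_apply, const_apply, zS_apply, tS_apply,
      iS_apply, ← hH'] at h1
    linear_combination h1
  rw [← hζp]
  have hζ0 : ζ.1 p ≠ 0 := fun h1 => by
    have h2 := congrArg (fun F : SmoothFun n => F.1 p) hζg
    exact Complex.I_ne_zero (by simpa [h1] using h2.symm)
  refine ⟨norm_pos_iff.2 hζ0, ?_⟩
  have h1 : ∀ α, k α + 2 * Complex.I * conj (p.1 α) = -2 * ζ.1 p * (L α f).1 p := by
    intro α
    have h2 := congrArg (fun F : SmoothFun n => F.1 p) (hLζ α)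
    have h3 := congrArg (fun F : SmoothFun n => F.1 p) (hLF α)
    simp only [SmoothFun.sub_apply, SmoothFun.mul_apply, SmoothFun.neg_apply,
      SmoothFun.ofNat_apply, iS_apply, cj_apply, zS_apply, hk] at h2 h3
    linear_combination h3 + h2
  -- Comparing the two expressions for Z_α ζ gives |ζ|²|∂f|², while `h3` gives |ζ|²(|∂f|² + e) = Im
  -- ζ; subtraction isolates |ζ|² e.
  have h2 : sqNorm (fun α => conj (k α)) + 4 * sqNorm p.1 + 4 * H.im =
      4 * Complex.normSq (ζ.1 p) * gradSqR f p := by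
    rw [gradSqR, Finset.mul_sum, hH', Complex.im_sum, sqNorm, sqNorm, Finset.mul_sum,
      Finset.mul_sum, ← Finset.sum_add_distrib, ← Finset.sum_add_distrib]
    refine Finset.sum_congr rfl fun α _ => ?_
    have h3 := congrArg Complex.normSq (h1 α)
    rw [Complex.normSq_mul, Complex.normSq_mul] at h3
    simp only [← Complex.normSq_eq_norm_sq]
    simp [Complex.normSq_apply] at h3 ⊢
    linarith
  have h3 : (ζ.1 p).im = Complex.normSq (ζ.1 p) * (gradSqR f p + (e.1 p).re) := by
    have h4 := congrArg (fun F : SmoothFun n => F.1 p) hζg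
    simp only [SmoothFun.mul_apply, iS_apply, h.gS_apply] at h4
    have h5 := congrArg (fun x => (conj (ζ.1 p) * x).re) h4
    simp [Complex.normSq_apply] at h5 ⊢
    linarith
  have h4 : (ζ.1 p).im = sqNorm p.1 + H.im + lam.im := by
    rw [hζp]; simp
  rw [← Complex.normSq_eq_norm_sq]
  linarith

omit he in
theorem f_apply_eq (p : Heisenberg n) : f.1 p = ((f.1 p).re : ℂ) := by
  have := congrArg (fun F : SmoothFun n => F.1 p) h.cj_f
  exact (Complex.conj_eq_iff_re.1 this).symm

/-- The extra β in the exponent of exp(f) cancels the term 2 conj(g) f_ᾱ in the derivative of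
conj(g), so only D, E, G remain from |g|^{-β}. -/
theorem exists_isWeight (β : ℝ) :
    ∃ W : SmoothFun n, IsWeight f e W (fun p => Real.exp (logWeight f e β p)) β := by
  have hlog : ContDiff ℝ ∞ fun p => Real.log (gSq f e p) :=
    (contDiff_gSq f e).log fun p => (h.gSq_pos he p).ne'
  set lg := ofRealFun _ hlog with hlg
  have hf : ContDiff ℝ ∞ fun p => (f.1 p).re := Complex.reCLM.contDiff.comp f.contDiff
  have hlw : ContDiff ℝ ∞ (logWeight f e β) :=
    (contDiff_const.mul hf).sub (contDiff_const.mul hlog)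
  set lw : SmoothFun n := ofRealFun _ hlw with hlwdef
  have hlw' : lw = const ((2 * n - 2 + β : ℝ) : ℂ) * f - const ((β / 2 : ℝ) : ℂ) * lg := by
    ext p
    simp only [hlwdef, hlg, ofRealFun_apply, logWeight, SmoothFun.sub_apply, SmoothFun.mul_apply,
      const_apply]
    conv_rhs => rw [h.f_apply_eq]
    push_cast; ring
  refine ⟨ofRealFun (fun p => Real.exp (logWeight f e β p)) (Real.contDiff_exp.comp hlw),
    fun p => rfl, fun p => Real.exp_pos _, fun α p => ?_⟩
  rw [Lb_comp_real α (F := lw) (r := logWeight f e β) (φ := Real.exp) (fun _ => rfl) (fun _ => rfl)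
    (Real.hasDerivAt_exp _)]
  congr 1
  have hg0 := (h.gSq_pos he p).ne'
  have h1 : (Lb α lg).1 p = ((gSq f e p)⁻¹ : ℝ) * (Lb α (gS f e * cj (gS f e))).1 p :=
    Lb_comp_real α (F := gS f e * cj (gS f e)) (r := gSq f e) (φ := Real.log)
      (fun x => by simp [gSq, Complex.mul_conj]) (fun _ => rfl) (Real.hasDerivAt_log hg0)
  rw [hlw', map_sub, der_mul, der_mul, der_const, der_const]
  simp only [SmoothFun.sub_apply, SmoothFun.add_apply, SmoothFun.mul_apply, const_apply,
    SmoothFun.zero_apply, h1]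
  rw [der_mul, h.Lb_gS, h.Lb_cj_gS]
  simp only [SmoothFun.sub_apply, SmoothFun.add_apply, SmoothFun.mul_apply, cj_apply,
    SmoothFun.ofNat_apply, h.gS_apply, map_add, map_sub, map_mul, Complex.conj_ofReal,
    Complex.conj_I]
  set a : ℝ := gradSqR f p + (e.1 p).re with ha
  have hr : ((gSq f e p : ℝ) : ℂ) = (a : ℂ) ^ 2 + (((T f).1 p).re : ℂ) ^ 2 := by
    rw [h.gSq_eq, ← ha]; push_cast; ring
  have hr0 : (a : ℂ) ^ 2 + (((T f).1 p).re : ℂ) ^ 2 ≠ 0 := by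
    rw [← hr]; exact_mod_cast hg0
  push_cast
  rw [hr]
  field_simp
  linear_combination (2 * β * (((T f).1 p).re : ℂ) ^ 2 * (Lb α f).1 p) * Complex.I_sq

end IsYamabeLog

/-! ### From the Yamabe equation to its logarithmic form -/

namespace IsPositiveSolution
variable {u : Heisenberg n → ℝ} (hu : IsPositiveSolution u)
include hu

theorem contDiff_log : ContDiff ℝ ∞ fun p => Real.log (u p) / n - Real.log 2 :=
  ((hu.smooth.log fun p => (hu.pos p).ne').div_const _).sub contDiff_const

/-- The function `f` with `u = 2ⁿ exp (n f)`. -/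
def logFun : SmoothFun n := ofRealFun _ hu.contDiff_log

/-- The function `exp (2f)`, where `u = 2ⁿ exp (n f)`. -/
def expFun : SmoothFun n :=
  ofRealFun (fun p => Real.exp (2 * (Real.log (u p) / n - Real.log 2)))
    (Real.contDiff_exp.comp (contDiff_const.mul hu.contDiff_log))

theorem eq_exp (hn : n ≠ 0) (p : Heisenberg n) :
    u p = 2 ^ n * Real.exp (n * (hu.logFun.1 p).re) := by
  have hn' : (n : ℝ) ≠ 0 := by exact_mod_cast hn
  have h1 : (n : ℝ) * (hu.logFun.1 p).re = Real.log (u p) - n * Real.log 2 := by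
    simp only [logFun, ofRealFun_apply, Complex.ofReal_re]; field_simp
  rw [h1, Real.exp_sub, Real.exp_log (hu.pos p), Real.exp_nat_mul, Real.exp_log two_pos]
  field_simp

theorem expFun_re (p : Heisenberg n) :
    (hu.expFun.1 p).re = Real.exp (2 * (hu.logFun.1 p).re) := rfl

theorem equation_logFun_re (hn : n ≠ 0) (p : Heisenberg n) :
    (∑ α, (Lb α (L α hu.logFun)).1 p).re =
      -(n * (gradSqR hu.logFun p + (hu.expFun.1 p).re)) := by
  set f := hu.logFun with hf
  have hn' : (n : ℝ) ≠ 0 := by exact_mod_cast hn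
  have hf' : ∀ x, f.1 x = ((f.1 x).re : ℂ) := fun x => rfl
  have hcf : cj f = f := cj_ofRealFun _ _
  have hLb : ∀ α, (Lb α f).1 p = conj ((L α f).1 p) := fun α => by
    conv_lhs => rw [← hcf]
    rw [Lb_cj]; rfl
  set U : SmoothFun n := ofRealFun u hu.smooth with hU
  have hUf : ∀ x, U.1 x = ((fun s : ℝ => 2 ^ n * Real.exp (n * s)) (f.1 x).re : ℝ) := fun x => by
    rw [hU, ofRealFun_apply, hu.eq_exp hn x]
  have hder : ∀ x, HasDerivAt (fun s : ℝ => 2 ^ n * Real.exp (n * s)) (n * u x) (f.1 x).re := by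
    intro x
    have h1 := (((hasDerivAt_id (f.1 x).re).const_mul (n : ℝ)).exp.const_mul ((2 : ℝ) ^ n))
    refine h1.congr_deriv ?_
    rw [hu.eq_exp hn x]
    simp only [id, ← hf]
    ring
  have hL : ∀ α, L α U = const n * (U * L α f) := by
    intro α
    ext x
    rw [L_comp_real α (r := fun x => (f.1 x).re) hf' hUf (hder x)]
    simp [hU, mul_assoc]
  have hLbL : ∀ α, (Lb α (L α U)).1 p = ((n * u p : ℝ) : ℂ) *
      (((n : ℝ) : ℂ) * ((Complex.normSq ((L α f).1 p) : ℝ) : ℂ) + (Lb α (L α f)).1 p) := by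
    intro α
    have h1 : (Lb α U).1 p = ((n * u p : ℝ) : ℂ) * conj ((L α f).1 p) := by
      rw [Lb_comp_real α (r := fun x => (f.1 x).re) hf' hUf (hder p), hLb]
    rw [hL, der_mul, der_mul, der_const, ← Complex.mul_conj]
    simp only [SmoothFun.add_apply, SmoothFun.mul_apply, h1, const_apply, SmoothFun.zero_apply]
    rw [show U.1 p = (u p : ℂ) from rfl]
    push_cast
    ring
  have hsub : subLaplacian u p = -(∑ α, (Lb α (L α U)).1 p).re := by
    have h1 : ∀ α, Zbar α (Z α fun x => (u x : ℂ)) p = (Lb α (L α U)).1 p := by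
      intro α
      rw [Lb_apply]
      congr 1
      funext x
      exact (L_apply α U x).symm
    simp only [subLaplacian, h1]
  have heq := hu.equation p
  rw [hsub, Finset.sum_congr rfl fun α _ => hLbL α, ← Finset.mul_sum, Complex.re_ofReal_mul,
    Finset.sum_add_distrib, Complex.add_re, ← Finset.mul_sum, Complex.re_ofReal_mul,
    ← Complex.ofReal_sum, Complex.ofReal_re] at heq
  -- The normalisation 2ⁿ is chosen so that u^{2/n} = 4 exp(2f), which cancels the factor 4 of the
  -- equation.
  have hpow : u p ^ (((n : ℝ) + 2) / n) = u p * (4 * (hu.expFun.1 p).re) := by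
    have h1 : ((n : ℝ) + 2) / n = 1 + 2 / n := by field_simp
    rw [h1, Real.rpow_add (hu.pos p), Real.rpow_one, hu.expFun_re]
    congr 1
    conv_lhs => rw [hu.eq_exp hn p]
    rw [Real.mul_rpow (by positivity) (Real.exp_pos _).le, ← Real.rpow_natCast,
      ← Real.rpow_mul (by norm_num), ← Real.exp_mul]
    congr 1
    · rw [mul_div_cancel₀ _ hn']; norm_num
    · congr 1; field_simp
  rw [hpow] at heq
  have hup := (hu.pos p).ne'
  have hP : gradSqR f p = ∑ α, Complex.normSq ((L α f).1 p) := rfl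
  rw [← hP] at heq
  have h2 : (n * u p * 4) * ((∑ α, (Lb α (L α f)).1 p).re
      + (n * (gradSqR f p + (hu.expFun.1 p).re))) = 0 := by linarith
  have h3 := (mul_eq_zero.1 h2).resolve_left (by positivity)
  linarith

theorem isYamabeLog (hn : n ≠ 0) : IsYamabeLog hu.logFun hu.expFun where
  cj_f := cj_ofRealFun _ _
  cj_e := cj_ofRealFun _ _
  L_e α := by
    ext p
    have h1 : HasDerivAt (fun s : ℝ => Real.exp (2 * s))
        (2 * Real.exp (2 * (hu.logFun.1 p).re)) (hu.logFun.1 p).re := by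
      have := ((hasDerivAt_id (hu.logFun.1 p).re).const_mul (2 : ℝ)).exp
      exact this.congr_deriv (by simp [mul_comm])
    rw [L_comp_real α (F := hu.logFun) (r := fun x => (hu.logFun.1 x).re) (fun _ => rfl)
      (φ := fun s => Real.exp (2 * s)) (fun _ => rfl) h1]
    rw [SmoothFun.mul_apply, SmoothFun.mul_apply, SmoothFun.ofNat_apply,
      show hu.expFun.1 p = ((Real.exp (2 * (hu.logFun.1 p).re) : ℝ) : ℂ) from rfl]
    push_cast; ring
  T_e := by
    ext p
    have h1 : HasDerivAt (fun s : ℝ => Real.exp (2 * s))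
        (2 * Real.exp (2 * (hu.logFun.1 p).re)) (hu.logFun.1 p).re := by
      have := ((hasDerivAt_id (hu.logFun.1 p).re).const_mul (2 : ℝ)).exp
      exact this.congr_deriv (by simp [mul_comm])
    rw [T, dirDer_comp_real _ (F := hu.logFun) (r := fun x => (hu.logFun.1 x).re) (fun _ => rfl)
      (φ := fun s => Real.exp (2 * s)) (fun _ => rfl) h1]
    rw [SmoothFun.mul_apply, SmoothFun.mul_apply, SmoothFun.ofNat_apply,
      show hu.expFun.1 p = ((Real.exp (2 * (hu.logFun.1 p).re) : ℝ) : ℂ) from rfl]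
    push_cast; ring
  equation := by
    have hcf : cj hu.logFun = hu.logFun := cj_ofRealFun _ _
    set f := hu.logFun with hf
    -- The equation for u gives only the real part of Σ f_{αᾱ}; the imaginary part n f₀ is forced by
    -- the commutator.
    have h1 : cj (∑ α, Lb α (L α f)) = ∑ α, Lb α (L α f) - 2 * ((n : SmoothFun n) * (iS * T f)) := by
      rw [map_sum]
      have h2 : ∀ α, cj (Lb α (L α f)) = Lb α (L α f) - 2 * iS * T f := by
        intro α
        rw [← L_cj, ← Lb_cj, hcf, L_Lb, if_pos rfl]
      rw [Finset.sum_congr rfl fun α _ => h2 α, Finset.sum_sub_distrib]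
      simp
      ring
    have hTf : cj (T f) = T f := by rw [← T_cj, hcf]
    have hLf : ∀ α, Lb α f = cj (L α f) := fun α => by rw [← Lb_cj, hcf]
    ext p
    have hT : (T f).1 p = (((T f).1 p).re : ℂ) :=
      (Complex.conj_eq_iff_re.1 (congrArg (fun F : SmoothFun n => F.1 p) hTf)).symm
    have hP : (gradSq f).1 p = (gradSqR f p : ℂ) := by
      simp [gradSq, gradSqR, hLf, Complex.mul_conj]
    have he : hu.expFun.1 p = ((hu.expFun.1 p).re : ℂ) := rfl
    have h3 := congrArg (fun F : SmoothFun n => (F.1 p).im) h1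
    simp only [SmoothFun.sub_apply, SmoothFun.mul_apply, cj_apply, SmoothFun.ofNat_apply,
      SmoothFun.natCast_apply, iS_apply] at h3
    rw [hT] at h3
    have h4 := hu.equation_logFun_re hn p
    rw [← hf, ← SmoothFun.sum_apply] at h4
    simp only [SmoothFun.neg_apply, SmoothFun.mul_apply, gS, SmoothFun.natCast_apply,
      SmoothFun.sub_apply, SmoothFun.add_apply, iS_apply, hP]
    rw [hT, he]
    simp [-SmoothFun.sum_apply] at h3
    refine Complex.ext ?_ ?_
    · rw [h4]; simp
    · simp [-SmoothFun.sum_apply]; linarith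

end IsPositiveSolution

/-! ### The growth hypothesis and the conclusion -/

/-- From |g| ≥ e = exp(2f) the weight is at most exp((2n-2-β)f). If exp(f) ≥ 1/R, then R⁻⁴ is
dominated by exp(4f); otherwise the exponential itself is at most R^{-(2n-2-β)}, and R⁻⁴ times it is
below R^{-2n}. -/
theorem weighted_volume_bound {f e : SmoothFun n} (h : IsYamabeLog f e)
    (hef : ∀ p, (e.1 p).re = Real.exp (2 * (f.1 p).re)) (hn : 2 ≤ n) {β : ℝ} (hβ : 0 ≤ β)
    (hβ1 : β ≤ 1) {R : ℝ} (hR : 1 < R) (p : Heisenberg n) :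
    ((e.1 p).re ^ 2 + R⁻¹ ^ 4) * Real.exp (logWeight f e β p) ≤
      2 * Real.exp ((2 * n + 2 - β) * (f.1 p).re) + (R ^ (2 * n))⁻¹ := by
  have hR0 : 0 < R := by linarith
  have hn' : (2 : ℝ) ≤ n := by exact_mod_cast hn
  set F := (f.1 p).re with hF
  have hg : 4 * F ≤ Real.log (gSq f e p) := by
    have h1 : Real.exp (4 * F) ≤ gSq f e p := by
      rw [h.gSq_eq, hef]
      have : Real.exp (4 * F) = Real.exp (2 * F) ^ 2 := by rw [← Real.exp_nat_mul]; ring_nf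
      rw [this]
      have := gradSqR_nonneg f p
      have := Real.exp_pos (2 * F)
      nlinarith [sq_nonneg ((T f).1 p).re]
    rw [← Real.log_exp (4 * F)]
    exact Real.log_le_log (Real.exp_pos _) h1
  have hw : Real.exp (logWeight f e β p) ≤ Real.exp ((2 * n - 2 - β) * F) := by
    rw [Real.exp_le_exp, logWeight, ← hF]
    nlinarith
  have h1 : (e.1 p).re ^ 2 * Real.exp (logWeight f e β p) ≤ Real.exp ((2 * n + 2 - β) * F) := by
    calc (e.1 p).re ^ 2 * Real.exp (logWeight f e β p)
        ≤ Real.exp (2 * F) ^ 2 * Real.exp ((2 * n - 2 - β) * F) := by rw [hef]; gcongr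
      _ = _ := by rw [← Real.exp_nat_mul, ← Real.exp_add]; congr 1; push_cast; ring
  have hRe : R⁻¹ = Real.exp (-Real.log R) := by rw [Real.exp_neg, Real.exp_log hR0]
  have hlog : 0 < Real.log R := Real.log_pos hR
  have h2 : R⁻¹ ^ 4 * Real.exp (logWeight f e β p) ≤
      Real.exp ((2 * n + 2 - β) * F) + (R ^ (2 * n))⁻¹ := by
    have h3 : R⁻¹ ^ 4 * Real.exp (logWeight f e β p) ≤
        Real.exp (-(4 * Real.log R) + (2 * n - 2 - β) * F) := by
      rw [Real.exp_add, hRe, ← Real.exp_nat_mul]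
      refine mul_le_mul (le_of_eq (by congr 1; push_cast; ring)) hw (Real.exp_pos _).le
        (Real.exp_pos _).le
    refine h3.trans ?_
    rcases le_total (-Real.log R) F with hc | hc
    · have : Real.exp (-(4 * Real.log R) + (2 * n - 2 - β) * F) ≤
          Real.exp ((2 * n + 2 - β) * F) := Real.exp_le_exp.2 (by linarith)
      have : 0 ≤ (R ^ (2 * n))⁻¹ := by positivity
      linarith
    · have h4 : Real.exp (-(4 * Real.log R) + (2 * n - 2 - β) * F) ≤ (R ^ (2 * n))⁻¹ := by
        rw [← inv_pow, hRe, ← Real.exp_nat_mul, Real.exp_le_exp]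
        push_cast
        nlinarith [mul_le_mul_of_nonneg_left hc (by linarith : 0 ≤ 2 * (n : ℝ) - 2 - β)]
      have := Real.exp_pos ((2 * n + 2 - β) * F)
      linarith
  linarith

/-- A positive solution of the CR Yamabe equation with the given integral growth is extremal. -/
theorem exists_eq_extremal (hn : 2 ≤ n) {u : Heisenberg n → ℝ} (hu : IsPositiveSolution u)
    {C q : ℝ} (hC : 0 < C)
    (hq : q ∈ Set.Ioc ((2 * (n : ℝ) + 1) / n) ((2 * (n : ℝ) + 2) / n))
    (hint : ∀ R : ℝ, 1 < R → ∫ p in koranyiBall n R, u p ^ q ∂volume ≤ C * R ^ 2) :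
    ∃ (μ : Fin n → ℂ) (lam : ℂ), sqNorm μ < 4 * lam.im ∧
      ∀ p : Heisenberg n, u p = extremal μ lam p := by
  have hn0 : n ≠ 0 := by omega
  have hnp : (0 : ℝ) < n := by exact_mod_cast Nat.pos_of_ne_zero hn0
  have h := hu.isYamabeLog hn0
  have he : ∀ p, 0 < (hu.expFun.1 p).re := fun p => by rw [hu.expFun_re]; exact Real.exp_pos _
  obtain ⟨β, hβ⟩ : ∃ β : ℝ, β = 2 * n + 2 - n * q := ⟨_, rfl⟩
  -- The endpoints of the interval for q translate into β < 1 and β ≥ 0.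
  have hq1 : 2 * (n : ℝ) + 1 < n * q := by
    have := (div_lt_iff₀ hnp).1 hq.1; linarith
  have hq2 : n * q ≤ 2 * (n : ℝ) + 2 := by
    have := (le_div_iff₀ hnp).1 hq.2; linarith
  obtain ⟨W, hW⟩ := h.exists_isWeight he β
  have huc : Continuous fun p => u p ^ q :=
    hu.smooth.continuous.rpow_const fun p => .inl (hu.pos p).ne'
  have hexp : ∀ p, Real.exp ((2 * n + 2 - β) * (hu.logFun.1 p).re) ≤ u p ^ q := by
    intro p
    conv_rhs => rw [hu.eq_exp hn0 p]
    rw [Real.mul_rpow (by positivity) (Real.exp_pos _).le, ← Real.exp_mul]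
    have h1 : (2 * n + 2 - β) * (hu.logFun.1 p).re = n * (hu.logFun.1 p).re * q := by
      rw [hβ]; ring
    rw [h1]
    refine le_mul_of_one_le_left (Real.exp_pos _).le (Real.one_le_rpow ?_ (by nlinarith))
    exact one_le_pow₀ (by norm_num)
  have hH : ∃ A, ∀ R : ℝ, 1 < R → ∫ p in koranyiBall n (2 * R),
      ((hu.expFun.1 p).re ^ 2 + R⁻¹ ^ 4) * Real.exp (logWeight hu.logFun hu.expFun β p) ≤
        A * R ^ 2 := by
    -- The 8C is twice the growth bound at radius 2R; the second summand is the volume bound at 2R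
    -- multiplied by R^{-2n}.
    refine ⟨8 * C + 2 * Real.pi ^ n * 2 ^ (2 * n + 2), fun R hR => ?_⟩
    have hR0 : 0 < R := by linarith
    have hR2 : 0 < 2 * R := by linarith
    have c1 : Continuous fun p => (hu.expFun.1 p).re :=
      Complex.continuous_re.comp hu.expFun.continuous
    have c2 := hW.continuous
    have h1 : ∫ p in koranyiBall n (2 * R),
        ((hu.expFun.1 p).re ^ 2 + R⁻¹ ^ 4) * Real.exp (logWeight hu.logFun hu.expFun β p) ≤
        ∫ p in koranyiBall n (2 * R), (2 * u p ^ q + (R ^ (2 * n))⁻¹) := by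
      refine integral_mono (integrableOn_koranyiBall hR2 (by fun_prop))
        (integrableOn_koranyiBall hR2 (by fun_prop)) fun p => ?_
      have h2 := weighted_volume_bound h hu.expFun_re hn (β := β) (by linarith) (by linarith) hR p
      have h3 := hexp p
      simp only
      linarith
    have h4 : ∫ p in koranyiBall n (2 * R), (2 * u p ^ q + (R ^ (2 * n))⁻¹) =
        2 * (∫ p in koranyiBall n (2 * R), u p ^ q)
          + volume.real (koranyiBall n (2 * R)) * (R ^ (2 * n))⁻¹ := by
      rw [integral_add ((integrableOn_koranyiBall hR2 huc).const_mul 2)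
        (integrableOn_koranyiBall hR2 continuous_const), integral_const_mul, setIntegral_const,
        smul_eq_mul]
    have h5 := hint (2 * R) (by linarith)
    have h6 := mul_le_mul_of_nonneg_right (volume_koranyiBall_le (n := n) hR2)
      (by positivity : 0 ≤ (R ^ (2 * n))⁻¹)
    have h7 : 2 * Real.pi ^ n * (2 * R) ^ (2 * n + 2) * (R ^ (2 * n))⁻¹ =
        2 * Real.pi ^ n * 2 ^ (2 * n + 2) * R ^ 2 := by
      rw [mul_pow, pow_add R]
      field_simp
    linarith
  have hzero := h.jlQuant_eq_zero he hW hn (by linarith) (by linarith) hH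
  obtain ⟨μ, lam, hml⟩ := h.exists_affine_of_jlQuant_eq_zero he (by omega) hzero
  refine ⟨μ, lam, ?_, fun p => ?_⟩
  · have h1 := hml 0
    have h2 := mul_pos (pow_pos h1.1 2) (mul_pos four_pos (he 0))
    linarith [h1.2]
  · obtain ⟨hp, hml⟩ := hml p
    set N := ‖(p.2 : ℂ) + Complex.I * (sqNorm p.1 : ℂ) + herm μ p.1 + lam‖ with hN
    have h1 : 4 * lam.im - sqNorm μ = (2 * N * Real.exp (hu.logFun.1 p).re) ^ 2 := by
      rw [← hml, hu.expFun_re, two_mul (hu.logFun.1 p).re, Real.exp_add]; ring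
    rw [extremal, ← hN, h1, ← Real.rpow_natCast _ 2, ← Real.rpow_mul (by positivity),
      hu.eq_exp (by omega) p]
    have h2 : ((2 : ℕ) : ℝ) * ((n : ℝ) / 2) = (n : ℕ) := by push_cast; ring
    rw [h2, Real.rpow_natCast, mul_pow, mul_pow, Real.exp_nat_mul]
    field_simp

end CRYamabe
end

theorem theorem1p2 (n : ℕ) (hn : 2 ≤ n) (u : CRYamabe.Heisenberg n → ℝ)
    (hu : CRYamabe.IsPositiveSolution u) (C q : ℝ) (hC : 0 < C)
    (hq : q ∈ Set.Ioc ((2 * (n : ℝ) + 1) / n) ((2 * (n : ℝ) + 2) / n))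
    (hint : ∀ R : ℝ, 1 < R →
      ∫ p in CRYamabe.koranyiBall n R, u p ^ q ∂MeasureTheory.volume ≤ C * R ^ 2) :
    ∃ (μ : Fin n → ℂ) (lam : ℂ), CRYamabe.sqNorm μ < 4 * lam.im ∧
      ∀ p : CRYamabe.Heisenberg n, u p = CRYamabe.extremal μ lam p := by
  exact CRYamabe.exists_eq_extremal hn hu hC hq hint
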